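/- **Definitions.** A Steiner triple system of order $v$, an $\mathrm{STS}(v)$, is a set of $v$ points with a collection of 3-subsets (blocks) such that every pair of distinct points lies in exactly one block. In the game Nofil on an STS, played points are chosen one at a time. Given the set $P$ of points played so far, an unplayed point is *unplayable* if it is the only unplayed point of some block, and *available* otherwise; each turn plays an available point. The *available hypergraph* of a position has the available points as vertices, and its hyperedges are the sets $B\setminus P$, where $B$ runs over the blocks without unplayable points. A graph $G$ *is embedded* in an STS if some line of play reaches a position whose available hypergraph is a graph (all hyperedges have size 2) isomorphic to $G$. An integer $v\ge 1$ is *admissible* if $v\equiv 1,3 \pmod 6$. An embedding of $G$ in an $\mathrm{STS}(v)$ is *minimal* if $G$ is not embedded in any STS of order less than $v$. **Theorem.** For $a=1,2,\dots,9$ the star $K_{1,a-1}$ can be minimally embedded in an STS; the minimal orders are $1, 3, 13, 19, 15, 19, 25, 27, 31$, respectively. Let $a\ge 9$. Then $K_{1,a-1}$ can be embedded in - an $\mathrm{STS}(4a-3)$ if $a\equiv 0,4 \pmod 6$; - an $\mathrm{STS}(4a+3)$ if $a\equiv 1 \pmod 6$; - an $\mathrm{STS}(4a-1)$ if $a\equiv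 2 \pmod 6$; - an $\mathrm{STS}(4a-5)$ if $a\equiv 3,5 \pmod 6$. If $a\equiv 3,4,5 \pmod 6$, this embedding is minimal. In general, every STS in which $K_{1,a-1}$ is embedded has an admissible order $v\ge 4a-6$. If $a\equiv 0,2 \pmod 6$, the order given above is the second smallest admissible order $v\ge 4a-6$; if $a\equiv 1 \pmod 6$, it is the third smallest. -/

import Mathlib

/-- A Steiner triple system on the point set `V`: a collection of 3-subsets (blocks) of `V` such
that every pair of distinct points lies in exactly one block. -/
structure SteinerTripleSystem (V : Type*) where
  blocks : Set (Finset V)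
  card_eq_three : ∀ B ∈ blocks, B.card = 3
  existsUnique_block : ∀ x y : V, x ≠ y → ∃! B, B ∈ blocks ∧ x ∈ B ∧ y ∈ B

namespace SteinerTripleSystem

variable {V : Type*} [DecidableEq V] (S : SteinerTripleSystem V)

/-- When the points of `P` have been played, the point `x` is unplayable: it is unplayed and is the
only unplayed point of some block. -/
def Unplayable (P : Finset V) (x : V) : Prop :=
  x ∉ P ∧ ∃ B ∈ S.blocks, x ∈ B ∧ B.erase x ⊆ P

/-- When the points of `P` have been played, the point `x` is available: it is neither played nor
unplayable. -/
def Available (P : Finset V) (x : V) : Prop :=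
  x ∉ P ∧ ¬ S.Unplayable P x

/-- The sets of played points that can arise in a line of play of the game Nofil: starting from no
played point, each turn plays one available point. -/
inductive Reachable : Finset V → Prop
  | start : Reachable ∅
  | play (P : Finset V) (x : V) : Reachable P → S.Available P x → Reachable (insert x P)

/-- The hyperedges of the available hypergraph: the blocks without unplayable points, with their
played points removed. -/
def availableHyperedges (P : Finset V) : Set (Finset V) :=
  {E | ∃ B ∈ S.blocks, (∀ x ∈ B, ¬ S.Unplayable P x) ∧ E = B \ P}

/-- The graph on the available points formed by the two-element available hyperedges. -/
def availableGraph (P : Finset V) : SimpleGraph {x : V // S.Available P x} where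
  Adj x y := x ≠ y ∧ ({x.1, y.1} : Finset V) ∈ S.availableHyperedges P
  symm := ⟨fun x y h => ⟨h.1.symm, by rw [Finset.pair_comm]; exact h.2⟩⟩
  loopless := ⟨fun _ h => h.1 rfl⟩

/-- The graph `G` is embedded in `S`: some line of play of Nofil on `S` reaches a position whose
available hypergraph is a graph (all its hyperedges have two points) isomorphic to `G`. -/
def Embeds {W : Type*} (G : SimpleGraph W) : Prop :=
  ∃ P : Finset V, S.Reachable P ∧ (∀ E ∈ S.availableHyperedges P, E.card = 2) ∧
    Nonempty (G ≃g S.availableGraph P)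

end SteinerTripleSystem

/-- The star `K_{1,a-1}` on `a` vertices, for `a ≥ 1`. -/
def starGraphK (a : ℕ) : SimpleGraph (Fin 1 ⊕ Fin (a - 1)) :=
  completeBipartiteGraph (Fin 1) (Fin (a - 1))

/-- The set of all orders `v` such that `K_{1,a-1}` is embedded in some Steiner triple system of
order `v`. -/
def starOrders (a : ℕ) : Set ℕ :=
  {v | ∃ S : SteinerTripleSystem (Fin v), S.Embeds (starGraphK a)}

/-- The admissible orders of Steiner triple systems. -/
def AdmissibleOrder (v : ℕ) : Prop :=
  v % 6 = 1 ∨ v % 6 = 3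

/-- `v` is the `k`-th smallest of the admissible orders that are at least `L` (`k` starts at 1). -/
def IsKthAdmissibleFrom (L k v : ℕ) : Prop :=
  AdmissibleOrder v ∧ L ≤ v ∧ {w | AdmissibleOrder w ∧ L ≤ w ∧ w < v}.ncard + 1 = k

/-!
In a position whose available graph is `K_{1,a-1}`, each point is played, unplayable, the center or
a leaf. Since played points never contain a block, such a position is the same thing as an
assignment of these four roles in which two played points have an unplayable third point, every
unplayable point arises in this way, two leaves have an unplayable third point, and the center and
a leaf have a played third point. `StarSystem` records this, with the triple system in the algebraic
form of a Steiner quasigroup, and `StarSystem.mem_starOrders` turns it into an embedding.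

*Necessity.* The third points of the blocks through the center and the leaves are `a - 1` distinct
played points. The blocks through a played point `q` and the other played points have distinct
unplayable third points, and so do the blocks through `q` and the available points, except for the
two ends of an edge that `q` may play. With `p` played and `u` unplayable points this gives either
`p = a - 1` and `u ≥ 2 a - 4`, or `p ≥ a` and `u ≥ p + a - 1`; moreover `u ≤ p (p - 1) / 2`
(`exists_counts_of_embeds`). Hence the order is at least `4 a - 6`, and the exceptional bounds
for `a = 3` and `a = 4` follow as well. Admissibility is the usual double counting.

*Existence.* Bose's construction has the blocks `(x, i), (y, i), ((x + y) / 2, i + 1)` on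
`ZMod n × ZMod 3` for odd `n`. Each point is replaced by a copy of an elementary abelian 2-group `F`
and each block by the triples of elements of `F` with a fixed sum; the groups `{x} × ZMod 3 × F`,
extended by a common hole, are then filled with small triple systems. The
unplayable points are chosen in the fibres over a subgroup of index two of `F`. Two points outside
of these fibres have their third point inside, so that across groups the roles fit as soon as the
blocks through the center are taken care of; the remaining conditions concern one filling.

For `F` of order four and holes of 1, 3 and 9 points, filled to orders 13, 15 and 21, the center is
in the hole, and this settles `a ≡ 4, 5, 0` modulo 6 (`FourFill.mem_starOrders`). For `F` of order
two and a hole of one point the fillings are Fano planes. Here the center is in one of the groups,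
and three different fillings of that group settle `a ≡ 1, 2, 3` modulo 6
(`SixFill.mem_starOrders`). The small orders come from the doubling construction
(`doubleStar`), from two cyclic systems, and from a system of order 25.
-/

/-! ### Steiner quasigroups -/

/-- A Steiner quasigroup on `V`: the algebraic form of a Steiner triple system. For `x ≠ y` the
value `op x y` is the third point of the block through `x` and `y`. -/
structure SteinerOp (V : Type*) where
  op : V → V → V
  comm : ∀ x y, op x y = op y x
  op_op : ∀ x y, op x (op x y) = y
  idem : ∀ x, op x x = x

namespace SteinerOp

variable {V : Type*} (s : SteinerOp V)

theorem op_ne_left {x y : V} (h : x ≠ y) : s.op x y ≠ x := fun e =>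
  h (by have := s.op_op x y; rw [e, s.idem] at this; exact this)

theorem op_ne_right {x y : V} (h : x ≠ y) : s.op x y ≠ y := by
  rw [s.comm]; exact s.op_ne_left h.symm

theorem op_op_right (x y : V) : s.op (s.op x y) y = x := by
  rw [s.comm, s.comm x y, s.op_op]

theorem op_op_left (x y : V) : s.op (s.op x y) x = y := by
  rw [s.comm, s.op_op]

/-- Transport of a Steiner quasigroup along a bijection. -/
def congr {W : Type*} (e : V ≃ W) : SteinerOp W where
  op x y := e (s.op (e.symm x) (e.symm y))
  comm x y := by rw [s.comm]
  op_op x y := by simp [s.op_op]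
  idem x := by simp [s.idem]

variable [DecidableEq V]

/-- The block through the distinct points `x` and `y`. -/
def block (x y : V) : Finset V := {x, y, s.op x y}

theorem mem_block {x y z : V} : z ∈ s.block x y ↔ z = x ∨ z = y ∨ z = s.op x y := by
  simp [block]

theorem block_eq {u w x y : V} (hxy : x ≠ y) (hx : x ∈ s.block u w) (hy : y ∈ s.block u w) :
    s.block u w = s.block x y := by
  ext z
  rw [mem_block] at hx hy
  rw [mem_block, mem_block]
  rcases hx with rfl | rfl | rfl <;> rcases hy with rfl | rfl | rfl <;>
    simp only [s.op_op, s.op_op_right, s.op_op_left, ne_eq, not_true_eq_false] at hxy ⊢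
  · tauto
  · rw [s.comm y x]; tauto
  · rw [s.comm u x, s.op_op]; tauto
  · tauto
  · tauto

/-- The Steiner triple system of a Steiner quasigroup. -/
def toSTS : SteinerTripleSystem V where
  blocks := {B | ∃ x y, x ≠ y ∧ B = s.block x y}
  card_eq_three := by
    rintro B ⟨x, y, h, rfl⟩
    exact Finset.card_eq_three.2
      ⟨x, y, s.op x y, h, (s.op_ne_left h).symm, (s.op_ne_right h).symm, rfl⟩
  existsUnique_block := by
    intro x y h
    refine ⟨s.block x y, ⟨⟨x, y, h, rfl⟩, by simp [block], by simp [block]⟩, ?_⟩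
    rintro B ⟨⟨u, w, huw, rfl⟩, hx, hy⟩
    exact s.block_eq h hx hy

theorem block_mem {x y : V} (h : x ≠ y) : s.block x y ∈ s.toSTS.blocks := ⟨x, y, h, rfl⟩

theorem eq_block_of_mem {B : Finset V} (hB : B ∈ s.toSTS.blocks) {x y : V} (h : x ≠ y)
    (hx : x ∈ B) (hy : y ∈ B) : B = s.block x y := by
  obtain ⟨u, w, _, rfl⟩ := hB
  exact s.block_eq h hx hy

theorem exists_pair {x : V} {B : Finset V} (hB : B ∈ s.toSTS.blocks) (hx : x ∈ B) :
    ∃ y, x ≠ y ∧ y ∈ B ∧ B = s.block x y := by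
  have hc : 1 < B.card := by rw [s.toSTS.card_eq_three B hB]; norm_num
  obtain ⟨y, hy, hyx⟩ := Finset.exists_mem_ne hc x
  exact ⟨y, hyx.symm, hy, s.eq_block_of_mem hB hyx.symm hx hy⟩

end SteinerOp

/-! ### Positions whose available hypergraph is a star -/

/-- The state of a point in a position whose available graph is a star. -/
inductive Role
  | played
  | center
  | leaf
  | dead
  deriving DecidableEq

namespace Role

/-- The condition on the role `t` of the third point of a block imposed by the roles `r` and `s` of
the other two: two played points make it unplayable, two leaves have it
unplayable, and the center and a leaf have it played. -/
def Fits : Role → Role → Role → Prop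
  | played, played, t => t = dead
  | leaf, leaf, t => t = dead
  | center, leaf, t => t = played
  | _, _, _ => True

instance : ∀ r s t, Decidable (Fits r s t) := by
  intro r s t
  cases r <;> cases s <;> unfold Fits <;> infer_instance

/-- In a block without unplayable points the roles are those of the center, a leaf and a played
point. -/
theorem perm_of_fits (r s t : Role) (hr : r ≠ dead) (hs : s ≠ dead) (ht : t ≠ dead)
    (hrs : ¬ (r = center ∧ s = center)) (hrt : ¬ (r = center ∧ t = center))
    (hst : ¬ (s = center ∧ t = center)) (f1 : Fits r s t) (f2 : Fits s r t) (f3 : Fits r t s)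
    (f4 : Fits t r s) (f5 : Fits s t r) (f6 : Fits t s r) :
    (r = center ∧ s = leaf ∧ t = played) ∨ (r = center ∧ s = played ∧ t = leaf) ∨
      (r = leaf ∧ s = center ∧ t = played) ∨ (r = played ∧ s = center ∧ t = leaf) ∨
      (r = leaf ∧ s = played ∧ t = center) ∨ (r = played ∧ s = leaf ∧ t = center) := by
  cases r <;> cases s <;> cases t <;> simp_all [Fits]

end Role

/-- A Steiner quasigroup with an assignment of roles to its points that describes a position whose
available hypergraph is a star. -/
structure StarSystem (V : Type*) extends SteinerOp V where
  role : V → Role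
  fits : ∀ x y, x ≠ y → Role.Fits (role x) (role y) (role (op x y))
  dead : ∀ z, role z = .dead → ∃ x y, x ≠ y ∧ role x = .played ∧ role y = .played ∧ op x y = z
  center : ∃! z, role z = .center

namespace StarSystem

variable {V : Type*} (s : StarSystem V)

theorem role_of_played {x y : V} (h : x ≠ y) (hx : s.role x = .played) (hy : s.role y = .played) :
    s.role (s.op x y) = .dead := by
  have := s.fits x y h; rwa [hx, hy] at this

theorem role_of_center_leaf {x y : V} (hx : s.role x = .center) (hy : s.role y = .leaf) :
    s.role (s.op x y) = .played := by
  have := s.fits x y (by rintro rfl; simp [hx] at hy); rwa [hx, hy] at this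

/-- Transport of a star position along a bijection. -/
def congr {W : Type*} (e : V ≃ W) : StarSystem W where
  toSteinerOp := s.toSteinerOp.congr e
  role x := s.role (e.symm x)
  fits x y h := by
    simpa [SteinerOp.congr] using s.fits (e.symm x) (e.symm y) (by simpa using h)
  dead z hz := by
    obtain ⟨x, y, h, hx, hy, hxy⟩ := s.dead _ hz
    exact ⟨e x, e y, by simpa using h, by simpa using hx, by simpa using hy, by
      simp [SteinerOp.congr, hxy]⟩
  center := by
    obtain ⟨z, hz, hu⟩ := s.center
    refine ⟨e z, by simpa using hz, fun y hy => ?_⟩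
    rw [← hu _ hy]; simp

end StarSystem

namespace SteinerTripleSystem

variable {V : Type*} [DecidableEq V] (S : SteinerTripleSystem V)

/-- A finite set of points without blocks inside can be played in any order. -/
theorem reachable_of_independent (P : Finset V) (hP : ∀ B ∈ S.blocks, ¬ B ⊆ P) :
    S.Reachable P := by
  induction P using Finset.induction_on with
  | empty => exact .start
  | insert x P hx ih =>
    refine .play P x (ih fun B hB h => hP B hB (h.trans (Finset.subset_insert _ _))) ⟨hx, ?_⟩
    rintro ⟨-, B, hB, hxB, hsub⟩
    refine hP B hB ?_
    rw [← Finset.insert_erase hxB]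
    exact Finset.insert_subset_insert _ hsub

end SteinerTripleSystem

namespace StarSystem

open SteinerTripleSystem

variable {V : Type*} [Fintype V] (s : StarSystem V)

/-- The points with the role `played`. -/
def playedSet : Finset V := Finset.univ.filter fun x => s.role x = .played

@[simp] theorem mem_playedSet {x : V} : x ∈ s.playedSet ↔ s.role x = .played := by
  simp [playedSet]

variable [DecidableEq V]

theorem unplayable_iff (x : V) : s.toSTS.Unplayable s.playedSet x ↔ s.role x = .dead := by
  constructor
  · rintro ⟨-, B, hB, hxB, hsub⟩
    obtain ⟨y, hxy, hy, rfl⟩ := s.exists_pair hB hxB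
    have h1 : s.role y = .played :=
      s.mem_playedSet.1 (hsub (Finset.mem_erase.2 ⟨hxy.symm, hy⟩))
    have h2 : s.role (s.op x y) = .played :=
      s.mem_playedSet.1 (hsub (Finset.mem_erase.2 ⟨s.op_ne_left hxy, s.mem_block.2 (by simp)⟩))
    have := s.role_of_played (s.op_ne_right hxy) h2 h1
    rwa [s.op_op_right] at this
  · intro hx
    obtain ⟨y, z, hyz, hy, hz, rfl⟩ := s.dead x hx
    refine ⟨by simp [hx], s.block y z, s.block_mem hyz, by simp [s.mem_block], ?_⟩
    intro w hw
    rw [Finset.mem_erase, s.mem_block] at hw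
    rcases hw with ⟨h, rfl | rfl | rfl⟩
    · simpa using hy
    · simpa using hz
    · exact absurd rfl h

theorem available_iff (x : V) :
    s.toSTS.Available s.playedSet x ↔ s.role x = .center ∨ s.role x = .leaf := by
  rw [Available, unplayable_iff, mem_playedSet]
  cases s.role x <;> simp

theorem reachable : s.toSTS.Reachable s.playedSet := by
  refine reachable_of_independent _ _ ?_
  rintro B ⟨x, y, h, rfl⟩ hsub
  have hm : ∀ z ∈ s.block x y, s.role z = .played := fun z hz => s.mem_playedSet.1 (hsub hz)
  have h1 := s.role_of_played h (hm x (by simp [s.mem_block])) (hm y (by simp [s.mem_block]))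
  rw [hm _ (by simp [s.mem_block])] at h1
  cases h1

/-- The available hyperedges are exactly the pairs of the center and a leaf. -/
theorem mem_availableHyperedges {E : Finset V} :
    E ∈ s.toSTS.availableHyperedges s.playedSet ↔
      ∃ x y, s.role x = .center ∧ s.role y = .leaf ∧ E = {x, y} := by
  constructor
  · rintro ⟨B, hB, hdead, rfl⟩
    have hdead' : ∀ x ∈ B, s.role x ≠ .dead := fun x hx h =>
      hdead x hx ((s.unplayable_iff x).2 h)
    obtain ⟨x, y, hxy, rfl⟩ := id hB
    have hx := hdead' x (by simp [s.mem_block])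
    have hy := hdead' y (by simp [s.mem_block])
    have hz := hdead' (s.op x y) (by simp [s.mem_block])
    have hxz := s.op_ne_left hxy
    have hyz := s.op_ne_right hxy
    have f1 := s.fits x y hxy
    have f2 := s.fits y x hxy.symm
    have f3 := s.fits x _ hxz.symm
    have f4 := s.fits _ x hxz
    have f5 := s.fits y _ hyz.symm
    have f6 := s.fits _ y hyz
    rw [s.comm y x] at f2
    rw [s.op_op] at f3
    rw [s.op_op_left] at f4
    rw [s.comm x y, s.op_op, s.comm y x] at f5
    rw [s.op_op_right] at f6
    have hne : ∀ p q, p ≠ q → ¬ (s.role p = .center ∧ s.role q = .center) := fun p q h hpq =>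
      h (s.center.unique hpq.1 hpq.2)
    -- the played point of a block without unplayable points is removed
    have key : ∀ p q r : V, s.role p = .center → s.role q = .leaf → s.role r = .played →
        s.block x y = {p, q, r} → ∃ u w, s.role u = .center ∧ s.role w = .leaf ∧
          s.block x y \ s.playedSet = {u, w} := by
      intro p q r hp hq hr hB
      refine ⟨p, q, hp, hq, ?_⟩
      ext z
      rw [hB, Finset.mem_sdiff, mem_playedSet]
      simp only [Finset.mem_insert, Finset.mem_singleton]
      constructor
      · rintro ⟨rfl | rfl | rfl, h⟩
        · simp
        · simp
        · exact absurd hr h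
      · rintro (rfl | rfl)
        · simp [hp]
        · simp [hq]
    have hb : ∀ w, w ∈ s.block x y ↔ w = x ∨ w = y ∨ w = s.op x y := fun w => s.mem_block
    rcases Role.perm_of_fits _ _ _ hx hy hz (hne _ _ hxy) (hne _ _ hxz.symm) (hne _ _ hyz.symm)
      f1 f2 f3 f4 f5 f6 with h | h | h | h | h | h <;> obtain ⟨ex, ey, ez⟩ := h
    · exact key _ _ _ ex ey ez rfl
    · exact key _ _ _ ex ez ey (by
        ext w; rw [hb]; simp only [Finset.mem_insert, Finset.mem_singleton]; tauto)
    · exact key _ _ _ ey ex ez (by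
        ext w; rw [hb]; simp only [Finset.mem_insert, Finset.mem_singleton]; tauto)
    · exact key _ _ _ ey ez ex (by
        ext w; rw [hb]; simp only [Finset.mem_insert, Finset.mem_singleton]; tauto)
    · exact key _ _ _ ez ex ey (by
        ext w; rw [hb]; simp only [Finset.mem_insert, Finset.mem_singleton]; tauto)
    · exact key _ _ _ ez ey ex (by
        ext w; rw [hb]; simp only [Finset.mem_insert, Finset.mem_singleton]; tauto)
  · rintro ⟨x, y, hx, hy, rfl⟩
    have hxy : x ≠ y := by rintro rfl; simp [hx] at hy
    have hz := s.role_of_center_leaf hx hy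
    refine ⟨s.block x y, s.block_mem hxy, ?_, ?_⟩
    · intro z h
      rw [unplayable_iff]
      rcases s.mem_block.1 h with rfl | rfl | rfl <;> simp [*]
    · ext z
      simp only [Finset.mem_sdiff, s.mem_block, mem_playedSet, Finset.mem_insert,
        Finset.mem_singleton]
      constructor
      · rintro (rfl | rfl)
        · simp [hx]
        · simp [hy]
      · rintro ⟨rfl | rfl | rfl, h⟩
        · simp
        · simp
        · exact absurd hz h

/-- A star position with `a - 1` leaves realises an embedding of `K_{1,a-1}`. -/
theorem embeds {a : ℕ} (ha : Fintype.card {x // s.role x = .leaf} = a - 1) :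
    s.toSTS.Embeds (starGraphK a) := by
  refine ⟨s.playedSet, s.reachable, ?_, ?_⟩
  · intro E hE
    obtain ⟨x, y, hx, hy, rfl⟩ := s.mem_availableHyperedges.1 hE
    exact Finset.card_pair (by rintro rfl; simp [hx] at hy)
  · obtain ⟨c, hc, hu⟩ := s.center
    let e : {x // s.role x = .leaf} ≃ Fin (a - 1) := Fintype.equivFinOfCardEq ha
    let f : Fin 1 ⊕ Fin (a - 1) → {x // s.toSTS.Available s.playedSet x} :=
      Sum.elim (fun _ => ⟨c, (s.available_iff c).2 (.inl hc)⟩)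
        (fun i => ⟨(e.symm i).1, (s.available_iff _).2 (.inr (e.symm i).2)⟩)
    have hf : Function.Bijective f := by
      constructor
      · rintro (i | i) (j | j) h
        · rw [Subsingleton.elim i j]
        · have := congrArg (fun x => s.role x.1) h
          simp [f, hc, (e.symm j).2] at this
        · have := congrArg (fun x => s.role x.1) h
          simp [f, hc, (e.symm i).2] at this
        · have := Subtype.ext_iff.1 h
          simpa [f, Subtype.ext_iff.symm] using this
      · rintro ⟨x, hx⟩
        rcases (s.available_iff x).1 hx with h | h
        · exact ⟨.inl 0, by simp [f, hu x h]⟩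
        · exact ⟨.inr (e ⟨x, h⟩), by simp [f]⟩
    have hadj : ∀ x y : {x // s.toSTS.Available s.playedSet x},
        (s.toSTS.availableGraph s.playedSet).Adj x y ↔
          (s.role x = .center ∧ s.role y = .leaf) ∨ (s.role x = .leaf ∧ s.role y = .center) := by
      intro x y
      change (x ≠ y ∧ _ ∈ _) ↔ _
      rw [s.mem_availableHyperedges]
      constructor
      · rintro ⟨hne, u, w, hu, hw, he⟩
        have hx : x.1 ∈ ({u, w} : Finset V) := by rw [← he]; simp
        have hy : y.1 ∈ ({u, w} : Finset V) := by rw [← he]; simp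
        simp only [Finset.mem_insert, Finset.mem_singleton] at hx hy
        have hne' : x.1 ≠ y.1 := fun h => hne (Subtype.ext h)
        rcases hx with hx | hx <;> rcases hy with hy | hy
        · exact absurd (hx.trans hy.symm) hne'
        · left; rw [hx, hy]; exact ⟨hu, hw⟩
        · right; rw [hx, hy]; exact ⟨hw, hu⟩
        · exact absurd (hx.trans hy.symm) hne'
      · rintro (⟨hx, hy⟩ | ⟨hx, hy⟩)
        · exact ⟨by rintro rfl; simp [hx] at hy, _, _, hx, hy, rfl⟩
        · exact ⟨by rintro rfl; simp [hx] at hy, _, _, hy, hx, Finset.pair_comm _ _⟩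
    refine ⟨⟨Equiv.ofBijective f hf, ?_⟩⟩
    intro x y
    rw [hadj]
    rcases x with i | i <;> rcases y with j | j <;>
      simp [f, hc, (e.symm _).2, starGraphK, completeBipartiteGraph]

end StarSystem

/-- A star position on any set of `v` points shows that `v` is the order of an embedding. -/
theorem StarSystem.mem_starOrders {V : Type*} [Fintype V] [DecidableEq V] (s : StarSystem V)
    {a v : ℕ} (hv : Fintype.card V = v) (ha : Fintype.card {x // s.role x = .leaf} = a - 1) :
    v ∈ starOrders a := by
  let e : V ≃ Fin v := Fintype.equivFinOfCardEq hv
  refine ⟨(s.congr e).toSTS, (s.congr e).embeds ?_⟩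
  rw [← ha]
  exact (Fintype.card_congr (e.subtypeEquiv fun x => by simp [StarSystem.congr])).symm

/-! ### The necessary conditions -/

namespace SteinerTripleSystem

variable {V : Type*} (S : SteinerTripleSystem V)

theorem block_unique {B C : Finset V} (hB : B ∈ S.blocks) (hC : C ∈ S.blocks) {x y : V}
    (h : x ≠ y) (hxB : x ∈ B) (hyB : y ∈ B) (hxC : x ∈ C) (hyC : y ∈ C) : B = C :=
  (S.existsUnique_block x y h).unique ⟨hB, hxB, hyB⟩ ⟨hC, hxC, hyC⟩

variable [DecidableEq V]

theorem exists_third (x y : V) (h : x ≠ y) : ∃ z, z ≠ x ∧ z ≠ y ∧ {x, y, z} ∈ S.blocks := by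
  obtain ⟨B, ⟨hB, hx, hy⟩, -⟩ := S.existsUnique_block x y h
  have h1 : ((B.erase x).erase y).card = 1 := by
    rw [Finset.card_erase_of_mem (Finset.mem_erase.2 ⟨h.symm, hy⟩), Finset.card_erase_of_mem hx,
      S.card_eq_three B hB]
  obtain ⟨z, hz⟩ := Finset.card_eq_one.1 h1
  have hz' : z ∈ (B.erase x).erase y := by simp [hz]
  simp only [Finset.mem_erase] at hz'
  refine ⟨z, hz'.2.1, hz'.1, ?_⟩
  have : B = {x, y, z} := by
    rw [← hz, Finset.insert_erase (Finset.mem_erase.2 ⟨h.symm, hy⟩), Finset.insert_erase hx]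
  rwa [← this]

open Classical in
/-- The third point of the block through two distinct points, and the point itself if the two
points coincide. -/
noncomputable def third (x y : V) : V :=
  if h : x = y then x else (S.exists_third x y h).choose

theorem third_self (x : V) : S.third x x = x := by simp [third]

theorem third_ne_left {x y : V} (h : x ≠ y) : S.third x y ≠ x := by
  rw [third, dif_neg h]; exact (S.exists_third x y h).choose_spec.1

theorem third_ne_right {x y : V} (h : x ≠ y) : S.third x y ≠ y := by
  rw [third, dif_neg h]; exact (S.exists_third x y h).choose_spec.2.1

theorem block_third {x y : V} (h : x ≠ y) : {x, y, S.third x y} ∈ S.blocks := by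
  rw [third, dif_neg h]; exact (S.exists_third x y h).choose_spec.2.2

theorem third_eq {x y z : V} (h : x ≠ y) (hx : z ≠ x) (hy : z ≠ y) {B : Finset V}
    (hB : B ∈ S.blocks) (hxB : x ∈ B) (hyB : y ∈ B) (hzB : z ∈ B) : S.third x y = z := by
  rw [S.block_unique hB (S.block_third h) h hxB hyB (by simp) (by simp)] at hzB
  simp only [Finset.mem_insert, Finset.mem_singleton, hx, hy, false_or] at hzB
  exact hzB.symm

/-- The Steiner quasigroup of a Steiner triple system. -/
noncomputable def toOp : SteinerOp V where
  op := S.third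
  comm x y := by
    by_cases h : x = y
    · rw [h]
    · exact S.third_eq h (S.third_ne_right (Ne.symm h)) (S.third_ne_left (Ne.symm h))
        (S.block_third (Ne.symm h)) (by simp) (by simp) (by simp)
  op_op x y := by
    by_cases h : x = y
    · rw [h, S.third_self, S.third_self]
    · exact S.third_eq (S.third_ne_left h).symm (Ne.symm h) (S.third_ne_right h).symm
        (S.block_third h) (by simp) (by simp) (by simp)
  idem := S.third_self

/-- The order of a non-empty Steiner triple system is admissible. -/
theorem admissibleOrder (S : SteinerTripleSystem V) [Fintype V] [Nonempty V] :
    AdmissibleOrder (Fintype.card V) := by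
  classical
  -- the blocks through `x` partition the other points into pairs, so the order is odd
  have hodd : ∀ x : V, ((Finset.univ : Finset V).erase x).card * 1 =
      (Finset.univ.filter fun B : Finset V => B ∈ S.blocks ∧ x ∈ B).card * 2 := by
    intro x
    refine Finset.card_mul_eq_card_mul (fun y B => y ∈ B) ?_ ?_
    · intro y hy
      rw [Finset.mem_erase] at hy
      obtain ⟨B, ⟨hB, hx, hyB⟩, hu⟩ := S.existsUnique_block x y hy.1.symm
      rw [Finset.card_eq_one]
      refine ⟨B, ?_⟩
      ext C
      simp only [Finset.mem_bipartiteAbove, Finset.mem_filter, Finset.mem_univ, true_and,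
        Finset.mem_singleton]
      constructor
      · rintro ⟨⟨h1, h2⟩, h3⟩; exact hu C ⟨h1, h2, h3⟩
      · rintro rfl; exact ⟨⟨hB, hx⟩, hyB⟩
    · intro B hB
      simp only [Finset.mem_filter, Finset.mem_univ, true_and] at hB
      have : Finset.bipartiteBelow (fun y (B : Finset V) => y ∈ B) (Finset.univ.erase x) B =
          B.erase x := by
        ext y; simp [Finset.mem_bipartiteBelow]
      rw [this, Finset.card_erase_of_mem hB.2, S.card_eq_three B hB.1]
  -- each block contains six ordered pairs, so the number of these is divisible by six
  have hsix : (Finset.univ : Finset V).offDiag.card * 1 =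
      (Finset.univ.filter fun B : Finset V => B ∈ S.blocks).card * 6 := by
    refine Finset.card_mul_eq_card_mul (fun (q : V × V) B => q.1 ∈ B ∧ q.2 ∈ B) ?_ ?_
    · rintro ⟨x, y⟩ hxy
      simp only [Finset.mem_offDiag, Finset.mem_univ, true_and] at hxy
      obtain ⟨B, ⟨hB, hx, hyB⟩, hu⟩ := S.existsUnique_block x y hxy
      rw [Finset.card_eq_one]
      refine ⟨B, ?_⟩
      ext C
      simp only [Finset.mem_bipartiteAbove, Finset.mem_filter, Finset.mem_univ, true_and,
        Finset.mem_singleton]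
      constructor
      · rintro ⟨h1, h2, h3⟩; exact hu C ⟨h1, h2, h3⟩
      · rintro rfl; exact ⟨hB, hx, hyB⟩
    · intro B hB
      simp only [Finset.mem_filter, Finset.mem_univ, true_and] at hB
      have : Finset.bipartiteBelow (fun (q : V × V) (B : Finset V) => q.1 ∈ B ∧ q.2 ∈ B)
          (Finset.univ : Finset V).offDiag B = B.offDiag := by
        ext ⟨x, y⟩; simp [Finset.mem_bipartiteBelow, Finset.mem_offDiag]; tauto
      rw [this, Finset.offDiag_card, S.card_eq_three B hB]
  obtain ⟨x⟩ := ‹Nonempty V›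
  have h1 := hodd x
  rw [Finset.card_erase_of_mem (Finset.mem_univ x), Finset.card_univ] at h1
  rw [Finset.offDiag_card, Finset.card_univ] at hsix
  have hpos : 0 < Fintype.card V := Fintype.card_pos_iff.2 ⟨x⟩
  generalize (Finset.univ.filter fun B : Finset V => B ∈ S.blocks).card = b at hsix
  generalize (Finset.univ.filter fun B : Finset V => B ∈ S.blocks ∧ x ∈ B).card = r at h1
  obtain ⟨w, hw⟩ : ∃ w, Fintype.card V = 2 * w + 1 := ⟨r, by omega⟩
  rw [hw] at hsix ⊢
  have h3 : (2 * w + 1) * (2 * w + 1) - (2 * w + 1) = 2 * (w * (2 * w + 1)) := by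
    rw [show (2 * w + 1) * (2 * w + 1) = 2 * (w * (2 * w + 1)) + (2 * w + 1) by ring]
    omega
  rw [h3] at hsix
  have h4 : w * (2 * w + 1) % 3 = 0 := by omega
  have h5 : w % 3 = 0 ∨ w % 3 = 1 := by
    have : w % 3 = 0 ∨ w % 3 = 1 ∨ w % 3 = 2 := by omega
    rcases this with h | h | h
    · exact .inl h
    · exact .inr h
    · rw [Nat.mul_mod, Nat.add_mod, Nat.mul_mod 2 w, h] at h4
      norm_num at h4
  unfold AdmissibleOrder
  omega

theorem independent_of_reachable {P : Finset V} (h : S.Reachable P) :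
    ∀ B ∈ S.blocks, ¬ B ⊆ P := by
  induction h with
  | start =>
    intro B hB hsub
    have := S.card_eq_three B hB
    rw [Finset.subset_empty.1 hsub] at this
    simp at this
  | play P x hP hx ih =>
    intro B hB hsub
    by_cases hxB : x ∈ B
    · refine hx.2 ⟨hx.1, B, hB, hxB, ?_⟩
      intro y hy
      rw [Finset.mem_erase] at hy
      exact (Finset.mem_insert.1 (hsub hy.2)).resolve_left hy.1
    · refine ih B hB fun y hy => (Finset.mem_insert.1 (hsub hy)).resolve_left ?_
      rintro rfl; exact hxB hy

/-- The counts behind the bounds on the order: in a position whose available graph is the star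
`K_{1,a-1}`, with `p` played and `u` unplayable points, the unplayable points are third points of
pairs of played points, and the blocks through one played point `q` and the other played points or
the available points off the at most one edge played by `q` have distinct unplayable third
points. -/
theorem exists_counts_of_embeds [Fintype V] {a : ℕ} (ha : 2 ≤ a) (h : S.Embeds (starGraphK a)) :
    ∃ p u : ℕ, p + a + u = Fintype.card V ∧ u * 2 ≤ p * p - p ∧
      ((p + 1 = a ∧ 2 * a ≤ u + 4) ∨ (a ≤ p ∧ p + a ≤ u + 1)) := by
  classical
  obtain ⟨P, hreach, hedge, ⟨φ⟩⟩ := h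
  have hind := S.independent_of_reachable hreach
  let o := S.toOp
  have hblock : ∀ {x y}, x ≠ y → {x, y, o.op x y} ∈ S.blocks := fun h => S.block_third h
  set A := Finset.univ.filter fun x => S.Available P x with hA
  set U := Finset.univ.filter fun x => S.Unplayable P x with hU
  have mA : ∀ x, x ∈ A ↔ S.Available P x := by simp [hA]
  have mU : ∀ x, x ∈ U ↔ S.Unplayable P x := by simp [hU]
  have tri : ∀ x, x ∉ P → x ∉ A → x ∈ U := by
    intro x h1 h2
    rw [mA] at h2; rw [mU]
    by_contra h3
    exact h2 ⟨h1, h3⟩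
  -- the sizes of the three classes of points
  have hcardA : A.card = a := by
    have h1 : Fintype.card {x // S.Available P x} = Fintype.card (Fin 1 ⊕ Fin (a - 1)) :=
      (Fintype.card_congr φ.toEquiv).symm
    rw [Fintype.card_subtype] at h1
    rw [hA, h1]; simp; omega
  have hsum : P.card + a + U.card = Fintype.card V := by
    have d1 : Disjoint P A := Finset.disjoint_left.2 fun x h1 h2 => ((mA x).1 h2).1 h1
    have d2 : Disjoint (P ∪ A) U := Finset.disjoint_left.2 fun x h1 h2 => by
      rcases Finset.mem_union.1 h1 with h | h
      · exact ((mU x).1 h2).1 h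
      · exact ((mA x).1 h).2 ((mU x).1 h2)
    rw [← hcardA, ← Finset.card_union_of_disjoint d1, ← Finset.card_union_of_disjoint d2,
      ← Finset.card_univ]
    congr 1
    ext x
    simp only [Finset.mem_union, Finset.mem_univ, iff_true]
    by_cases h1 : x ∈ P
    · exact .inl (.inl h1)
    · by_cases h2 : x ∈ A
      · exact .inl (.inr h2)
      · exact .inr (tri x h1 h2)
  -- the third point of two played points is unplayable, that of an available and a played point
  -- is not played
  have hPP : ∀ x ∈ P, ∀ y ∈ P, x ≠ y → o.op x y ∈ U := by
    intro x hx y hy hxy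
    rw [mU]
    refine ⟨fun hz => hind _ (hblock hxy) ?_, _, hblock hxy, by simp, ?_⟩
    · intro w hw
      simp only [Finset.mem_insert, Finset.mem_singleton] at hw
      rcases hw with rfl | rfl | rfl <;> assumption
    · intro w hw
      simp only [Finset.mem_erase, Finset.mem_insert, Finset.mem_singleton] at hw
      rcases hw with ⟨h, rfl | rfl | rfl⟩
      · assumption
      · assumption
      · exact absurd rfl h
  have hAP : ∀ x ∈ A, ∀ y ∈ P, o.op x y ∉ P := by
    intro x hx y hy hz
    have hxP := ((mA x).1 hx).1
    have hxy : x ≠ y := by rintro rfl; exact hxP hy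
    have := hPP _ hz y hy (o.op_ne_right hxy)
    rw [o.op_op_right, mU] at this
    exact ((mA x).1 hx).2 this
  let c := (φ (.inl 0)).1
  let l : Fin (a - 1) → V := fun i => (φ (.inr i)).1
  have hcA : c ∈ A := (mA c).2 (φ (.inl 0)).2
  have hlA : ∀ i, l i ∈ A := fun i => (mA _).2 (φ (.inr i)).2
  have hcl : ∀ i, c ≠ l i := by
    intro i h
    have := φ.injective (Subtype.ext h)
    simp at this
  have hlinj : Function.Injective l := by
    intro i j h
    have := φ.injective (Subtype.ext h)
    simpa using this
  have hclP : ∀ i, o.op c (l i) ∈ P := by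
    intro i
    have hadj : (S.availableGraph P).Adj (φ (.inl 0)) (φ (.inr i)) :=
      φ.map_adj_iff.2 (by simp [starGraphK, completeBipartiteGraph])
    obtain ⟨-, B, hB, -, hE⟩ := hadj
    have h1 : c ∈ B \ P := by rw [← hE]; simp [c]
    have h2 : l i ∈ B \ P := by rw [← hE]; simp [l]
    have h3 := S.block_unique hB (hblock (hcl i)) (hcl i) (Finset.mem_sdiff.1 h1).1
      (Finset.mem_sdiff.1 h2).1 (by simp) (by simp)
    by_contra h4
    have h5 : o.op c (l i) ∈ B \ P := Finset.mem_sdiff.2 ⟨by rw [h3]; simp, h4⟩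
    rw [← hE] at h5
    simp only [Finset.mem_insert, Finset.mem_singleton] at h5
    rcases h5 with h | h
    · exact o.op_ne_left (hcl i) h
    · exact o.op_ne_right (hcl i) h
  -- an edge has the center as one of its ends
  have hstar : ∀ x ∈ A, ∀ y ∈ A, x ≠ y → o.op x y ∈ P →
      (x = c ∧ ∃ i, y = l i) ∨ (y = c ∧ ∃ i, x = l i) := by
    intro x hx y hy hxy hz
    have hadj : (S.availableGraph P).Adj ⟨x, (mA x).1 hx⟩ ⟨y, (mA y).1 hy⟩ := by
      refine ⟨fun h => hxy (Subtype.ext_iff.1 h), _, hblock hxy, ?_, ?_⟩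
      · intro w hw hwU
        simp only [Finset.mem_insert, Finset.mem_singleton] at hw
        rcases hw with rfl | rfl | rfl
        · exact ((mA w).1 hx).2 hwU
        · exact ((mA w).1 hy).2 hwU
        · exact hwU.1 hz
      · ext w
        simp only [Finset.mem_insert, Finset.mem_singleton, Finset.mem_sdiff]
        constructor
        · rintro (rfl | rfl)
          · exact ⟨.inl rfl, ((mA w).1 hx).1⟩
          · exact ⟨.inr (.inl rfl), ((mA w).1 hy).1⟩
        · rintro ⟨rfl | rfl | rfl, h⟩
          · exact .inl rfl
          · exact .inr rfl
          · exact absurd hz h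
    obtain ⟨s, hs⟩ := φ.surjective ⟨x, (mA x).1 hx⟩
    obtain ⟨t, ht⟩ := φ.surjective ⟨y, (mA y).1 hy⟩
    rw [← hs, ← ht, φ.map_adj_iff] at hadj
    have hs' : x = (φ s).1 := by rw [hs]
    have ht' : y = (φ t).1 := by rw [ht]
    rcases s with s | s <;> rcases t with t | t
    · simp [starGraphK, completeBipartiteGraph] at hadj
    · left
      rw [Subsingleton.elim s 0] at hs'
      exact ⟨hs', t, ht'⟩
    · right
      rw [Subsingleton.elim t 0] at ht'
      exact ⟨ht', s, hs'⟩
    · simp [starGraphK, completeBipartiteGraph] at hadj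
  -- the third points of the blocks through the center and the leaves are distinct
  let f : Fin (a - 1) → V := fun i => o.op c (l i)
  have hf : Function.Injective f := by
    intro i j h
    apply hlinj
    rw [← o.op_op c (l i), ← o.op_op c (l j)]
    exact congrArg _ h
  have himg : Finset.univ.image f ⊆ P := by
    intro x hx
    obtain ⟨i, -, rfl⟩ := Finset.mem_image.1 hx
    exact hclP i
  have hcimg : (Finset.univ.image f).card = a - 1 := by
    rw [Finset.card_image_of_injective _ hf]; simp
  have hp := Finset.card_le_card himg
  rw [hcimg] at hp
  -- the third points of blocks through a played point
  have hcount : ∀ q ∈ P, ∀ k, (A.filter fun y => o.op q y ∈ A).card ≤ k →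
      P.card + a ≤ U.card + 1 + k := by
    intro q hq k hk
    have h1 : ((P.erase q ∪ A.filter fun y => o.op q y ∉ A).image (o.op q)) ⊆ U := by
      intro z hz
      obtain ⟨y, hy, rfl⟩ := Finset.mem_image.1 hz
      rw [Finset.mem_union, Finset.mem_erase, Finset.mem_filter] at hy
      rcases hy with ⟨h1, h2⟩ | ⟨h1, h2⟩
      · exact hPP q hq y h2 h1.symm
      · refine tri _ ?_ h2
        rw [o.comm]; exact hAP y h1 q hq
    have h2 := Finset.card_le_card h1
    have hinj : Function.Injective (o.op q) := by
      intro x y h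
      rw [← o.op_op q x, ← o.op_op q y, h]
    have hd : Disjoint (P.erase q) (A.filter fun y => o.op q y ∉ A) :=
      Finset.disjoint_left.2 fun x h1 h2 =>
        ((mA x).1 (Finset.mem_filter.1 h2).1).1 (Finset.mem_erase.1 h1).2
    rw [Finset.card_image_of_injective _ hinj, Finset.card_union_of_disjoint hd,
      Finset.card_erase_of_mem hq] at h2
    have h3 := Finset.card_filter_add_card_filter_not (s := A) (fun y => o.op q y ∈ A)
    have : 0 < P.card := Finset.card_pos.2 ⟨q, hq⟩
    omega
  have hthird : ∀ q ∈ P, ∀ y ∈ A, o.op q y ∈ A →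
      (y = c ∧ ∃ i, o.op q y = l i) ∨ (o.op q y = c ∧ ∃ i, y = l i) := by
    intro q hq y hy hz
    have hqy : q ≠ y := by rintro rfl; exact ((mA q).1 hy).1 hq
    refine hstar y hy _ hz (o.op_ne_right hqy).symm ?_
    rw [o.comm q y, o.op_op]
    exact hq
  refine ⟨P.card, U.card, hsum, ?_, ?_⟩
  · rw [← Finset.offDiag_card, ← mul_one P.offDiag.card]
    refine Finset.card_mul_le_card_mul (fun z (w : V × V) => o.op w.1 w.2 = z) ?_ ?_
    · intro z hz
      obtain ⟨hzP, B, hB, hzB, hsub⟩ := (mU z).1 hz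
      have h2 : (B.erase z).card = 2 := by
        rw [Finset.card_erase_of_mem hzB, S.card_eq_three B hB]
      obtain ⟨x, y, hxy, he⟩ := Finset.card_eq_two.1 h2
      have hx : x ∈ B.erase z := by simp [he]
      have hy : y ∈ B.erase z := by simp [he]
      have hzxy : o.op x y = z := S.third_eq hxy (Finset.mem_erase.1 hx).1.symm
        (Finset.mem_erase.1 hy).1.symm hB (Finset.mem_erase.1 hx).2 (Finset.mem_erase.1 hy).2 hzB
      have h3 : ({(x, y), (y, x)} : Finset (V × V)) ⊆
          P.offDiag.bipartiteAbove (fun z (w : V × V) => o.op w.1 w.2 = z) z := by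
        intro w hw
        simp only [Finset.mem_insert, Finset.mem_singleton] at hw
        rw [Finset.mem_bipartiteAbove, Finset.mem_offDiag]
        rcases hw with rfl | rfl
        · exact ⟨⟨hsub hx, hsub hy, hxy⟩, hzxy⟩
        · exact ⟨⟨hsub hy, hsub hx, hxy.symm⟩, by rw [o.comm]; exact hzxy⟩
      refine le_trans ?_ (Finset.card_le_card h3)
      rw [Finset.card_pair]
      intro h
      exact hxy (Prod.ext_iff.1 h).1
    · intro w _
      rw [Finset.card_le_one]
      intro x hx y hy
      rw [Finset.mem_bipartiteBelow] at hx hy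
      exact hx.2.symm.trans hy.2
  · by_cases hpa : P.card + 1 = a
    · left
      obtain ⟨q, hq⟩ : P.Nonempty := by rw [← Finset.card_pos]; omega
      refine ⟨hpa, ?_⟩
      -- `q` plays at most one edge, whose ends are the center and its third point
      have := hcount q hq 2 (by
        refine le_trans (Finset.card_le_card (t := {c, o.op q c}) ?_) Finset.card_le_two
        intro y hy
        rw [Finset.mem_filter] at hy
        rw [Finset.mem_insert, Finset.mem_singleton]
        rcases hthird q hq y hy.1 hy.2 with ⟨h, -⟩ | ⟨h, -⟩
        · exact .inl h
        · right; rw [← h, o.op_op])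
      omega
    · right
      have hpa' : a ≤ P.card := by omega
      refine ⟨hpa', ?_⟩
      -- some played point `q` is not the third point of the center and a leaf
      obtain ⟨q, hq, hqi⟩ := Finset.exists_mem_notMem_of_card_lt_card
        (s := Finset.univ.image f) (t := P) (by omega)
      have := hcount q hq 0 (by
        rw [Nat.le_zero, Finset.card_eq_zero, Finset.filter_eq_empty_iff]
        intro y hy hz
        apply hqi
        rw [Finset.mem_image]
        rcases hthird q hq y hy hz with ⟨rfl, i, hi⟩ | ⟨h, i, rfl⟩
        · exact ⟨i, Finset.mem_univ _, by simp only [f]; rw [← hi, o.comm q, o.op_op]⟩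
        · exact ⟨i, Finset.mem_univ _, by simp only [f]; rw [← h, o.op_op_right]⟩)
      omega

end SteinerTripleSystem

/-- The orders of embeddings of stars are admissible. -/
theorem admissibleOrder_of_mem_starOrders {a v : ℕ} (h : v ∈ starOrders a) :
    AdmissibleOrder v := by
  obtain ⟨S, P, -, -, ⟨φ⟩⟩ := h
  have : Nonempty (Fin v) := ⟨(φ (.inl 0)).1⟩
  simpa using S.admissibleOrder

theorem counts_of_mem_starOrders {a v : ℕ} (ha : 2 ≤ a) (h : v ∈ starOrders a) :
    ∃ p u : ℕ, p + a + u = v ∧ u * 2 ≤ p * p - p ∧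
      ((p + 1 = a ∧ 2 * a ≤ u + 4) ∨ (a ≤ p ∧ p + a ≤ u + 1)) := by
  obtain ⟨S, hS⟩ := h
  simpa using S.exists_counts_of_embeds ha hS

theorem le_of_mem_starOrders {a v : ℕ} (h : v ∈ starOrders a) : 4 * a - 6 ≤ v := by
  by_cases ha : 2 ≤ a
  · obtain ⟨p, u, h1, -, h2⟩ := counts_of_mem_starOrders ha h
    omega
  · omega

theorem eleven_le_of_mem_starOrders_three {v : ℕ} (h : v ∈ starOrders 3) : 11 ≤ v := by
  obtain ⟨p, u, h1, h2, ⟨h3, h4⟩ | h3⟩ := counts_of_mem_starOrders (by norm_num) h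
  · obtain rfl : p = 2 := by omega
    omega
  · omega

theorem sixteen_le_of_mem_starOrders_four {v : ℕ} (h : v ∈ starOrders 4) : 16 ≤ v := by
  obtain ⟨p, u, h1, h2, ⟨h3, h4⟩ | h3⟩ := counts_of_mem_starOrders (by norm_num) h
  · obtain rfl : p = 3 := by omega
    omega
  · by_contra h5
    obtain rfl : p = 4 := by omega
    omega

/-! ### Bose's construction with groups to be filled -/

section Bose

variable {R F : Type*} [CommRing R] [AddCommGroup F]

/-- The third point of the block through two points of different groups `{x} × ZMod 3 × F`. The
blocks of Bose's construction are `(x, i), (y, i), ((x + y) / 2, i + 1)`; each point is replaced by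
a copy of the elementary abelian 2-group `F`, and each block by the triples of elements of `F` with
sum `t x y`. Here `h` stands for `1 / 2`. -/
def boseThird (h : R) (t : R → R → F) (p q : R × ZMod 3 × F) : R × ZMod 3 × F :=
  if p.2.1 = q.2.1 then (h * (p.1 + q.1), p.2.1 + 1, p.2.2 + q.2.2 + t p.1 q.1)
  else if q.2.1 = p.2.1 + 1 then
    (2 * q.1 - p.1, p.2.1, p.2.2 + q.2.2 + t p.1 (2 * q.1 - p.1))
  else (2 * p.1 - q.1, q.2.1, p.2.2 + q.2.2 + t q.1 (2 * p.1 - q.1))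

variable {h : R} {t : R → R → F}

theorem boseThird_same (x y : R) (i : ZMod 3) (f g : F) :
    boseThird h t (x, i, f) (y, i, g) = (h * (x + y), i + 1, f + g + t x y) := by
  simp [boseThird]

theorem boseThird_next (x y : R) (i : ZMod 3) (f g : F) :
    boseThird h t (x, i, f) (y, i + 1, g) =
      (2 * y - x, i, f + g + t x (2 * y - x)) := by
  have h1 : i ≠ i + 1 := by revert i; decide
  simp [boseThird, h1]

theorem boseThird_prev (x y : R) (i : ZMod 3) (f g : F) :
    boseThird h t (x, i + 1, f) (y, i, g) =
      (2 * x - y, i, f + g + t y (2 * x - y)) := by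
  have h1 : i + 1 ≠ i := by revert i; decide
  have h2 : i ≠ i + 1 + 1 := by revert i; decide
  simp [boseThird, h1, h2]

theorem level_cases (i j : ZMod 3) : j = i ∨ j = i + 1 ∨ i = j + 1 := by
  revert i j; decide

theorem boseThird_comm (ht : ∀ x y, t x y = t y x) (p q : R × ZMod 3 × F) :
    boseThird h t p q = boseThird h t q p := by
  obtain ⟨x, i, f⟩ := p
  obtain ⟨y, j, g⟩ := q
  rcases level_cases i j with rfl | rfl | rfl
  · rw [boseThird_same, boseThird_same, add_comm x y, add_comm f g, ht]
  · rw [boseThird_next, boseThird_prev, add_comm f g]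
  · rw [boseThird_next, boseThird_prev, add_comm f g]

theorem boseThird_boseThird (hh : 2 * h = 1) (ht : ∀ x y, t x y = t y x)
    (hF : ∀ f : F, f + f = 0) (p q : R × ZMod 3 × F) :
    boseThird h t p (boseThird h t p q) = q := by
  have hF' : ∀ f g k : F, f + (f + g + k) + k = g := fun f g k => by
    calc f + (f + g + k) + k = (f + f) + g + (k + k) := by abel
      _ = g := by rw [hF, hF]; abel
  have e1 : ∀ x y : R, 2 * (h * (x + y)) - x = y := fun x y => by
    linear_combination (x + y) * hh
  have e2 : ∀ x y : R, h * (x + (2 * y - x)) = y := fun x y => by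
    linear_combination y * hh
  obtain ⟨x, i, f⟩ := p
  obtain ⟨y, j, g⟩ := q
  rcases level_cases i j with rfl | rfl | rfl
  · rw [boseThird_same, boseThird_next, e1, hF']
  · rw [boseThird_next, boseThird_same, e2, hF']
  · rw [boseThird_prev, boseThird_prev, sub_sub_cancel, ht, hF']

theorem boseThird_ne (hh : 2 * h = 1) {p q : R × ZMod 3 × F} (hpq : p.1 ≠ q.1) :
    p.1 ≠ (boseThird h t p q).1 := by
  have two : ∀ z : R, 2 * z = 0 → z = 0 := fun z hz => by
    linear_combination h * hz - z * hh
  obtain ⟨x, i, f⟩ := p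
  obtain ⟨y, j, g⟩ := q
  rcases level_cases i j with rfl | rfl | rfl
  · rw [boseThird_same]
    intro e
    apply hpq
    change x = h * (x + y) at e
    change x = y
    linear_combination 2 * e + (x + y) * hh
  · rw [boseThird_next]
    intro e
    apply hpq
    change x = 2 * y - x at e
    change x = y
    have := two (x - y) (by linear_combination e)
    linear_combination this
  · rw [boseThird_prev]
    intro e
    apply hpq
    change x = 2 * x - y at e
    change x = y
    linear_combination -e

variable {N : Type*}

/-- The inclusion of a filled group: the points of the group `x` together with those of the hole
`N`, which is common to all groups. -/
def groupIncl (x : R) : (ZMod 3 × F) ⊕ N → (R × ZMod 3 × F) ⊕ N :=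
  Sum.map (Prod.mk x) id

omit [CommRing R] [AddCommGroup F] in
theorem groupIncl_injective (x : R) :
    Function.Injective (groupIncl x : (ZMod 3 × F) ⊕ N → (R × ZMod 3 × F) ⊕ N) :=
  Sum.map_injective.2 ⟨Prod.mk_right_injective x, Function.injective_id⟩

variable [DecidableEq R]

/-- Bose's construction with the group `x`, extended by the hole `N`, filled with the system
`fill x`. -/
def boseOp (h : R) (t : R → R → F) (sub : SteinerOp N)
    (fill : R → SteinerOp ((ZMod 3 × F) ⊕ N)) :
    (R × ZMod 3 × F) ⊕ N → (R × ZMod 3 × F) ⊕ N → (R × ZMod 3 × F) ⊕ N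
  | .inr a, .inr b => .inr (sub.op a b)
  | .inr a, .inl q => groupIncl q.1 ((fill q.1).op (.inr a) (.inl q.2))
  | .inl p, .inr b => groupIncl p.1 ((fill p.1).op (.inl p.2) (.inr b))
  | .inl p, .inl q =>
    if p.1 = q.1 then groupIncl p.1 ((fill p.1).op (.inl p.2) (.inl q.2))
    else .inl (boseThird h t p q)

variable {sub : SteinerOp N} {fill : R → SteinerOp ((ZMod 3 × F) ⊕ N)}

theorem boseOp_group (hsub : ∀ x a b, (fill x).op (.inr a) (.inr b) = .inr (sub.op a b)) (x : R)
    (u v : (ZMod 3 × F) ⊕ N) :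
    boseOp h t sub fill (groupIncl x u) (groupIncl x v) = groupIncl x ((fill x).op u v) := by
  rcases u with u | u <;> rcases v with v | v
  · simp [groupIncl, boseOp]
  · simp [groupIncl, boseOp]
  · simp [groupIncl, boseOp]
  · simp [groupIncl, boseOp, hsub]

theorem boseOp_cross {p q : R × ZMod 3 × F} (hpq : p.1 ≠ q.1) :
    boseOp h t sub fill (.inl p) (.inl q) = .inl (boseThird h t p q) := by
  simp [boseOp, hpq]

omit [AddCommGroup F] [DecidableEq R] in
/-- Two points lie in a common filled group or are points of different groups. -/
theorem group_or_cross (u v : (R × ZMod 3 × F) ⊕ N) :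
    (∃ x u' v', u = groupIncl x u' ∧ v = groupIncl x v') ∨
      ∃ p q : R × ZMod 3 × F, p.1 ≠ q.1 ∧ u = .inl p ∧ v = .inl q := by
  rcases u with p | a <;> rcases v with q | b
  · by_cases h : p.1 = q.1
    · refine .inl ⟨p.1, .inl p.2, .inl q.2, rfl, ?_⟩
      rw [h]; rfl
    · exact .inr ⟨p, q, h, rfl, rfl⟩
  · exact .inl ⟨p.1, .inl p.2, .inr b, rfl, rfl⟩
  · exact .inl ⟨q.1, .inr a, .inl q.2, rfl, rfl⟩
  · exact .inl ⟨0, .inr a, .inr b, rfl, rfl⟩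

/-- Bose's construction with filled groups. -/
def boseSteinerOp (hh : 2 * h = 1) (ht : ∀ x y, t x y = t y x) (hF : ∀ f : F, f + f = 0)
    (hsub : ∀ x a b, (fill x).op (.inr a) (.inr b) = .inr (sub.op a b)) :
    SteinerOp ((R × ZMod 3 × F) ⊕ N) where
  op := boseOp h t sub fill
  comm u v := by
    rcases group_or_cross u v with ⟨x, u, v, rfl, rfl⟩ | ⟨p, q, hpq, rfl, rfl⟩
    · rw [boseOp_group hsub, boseOp_group hsub, (fill x).comm]
    · rw [boseOp_cross hpq, boseOp_cross hpq.symm, boseThird_comm ht]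
  op_op u v := by
    rcases group_or_cross u v with ⟨x, u, v, rfl, rfl⟩ | ⟨p, q, hpq, rfl, rfl⟩
    · rw [boseOp_group hsub, boseOp_group hsub, (fill x).op_op]
    · rw [boseOp_cross hpq, boseOp_cross (boseThird_ne hh hpq), boseThird_boseThird hh ht hF]
  idem u := by
    rcases group_or_cross u u with ⟨x, u, v, rfl, hv⟩ | ⟨p, q, hpq, rfl, hq⟩
    · rw [boseOp_group hsub, (fill x).idem]
    · exact absurd (congrArg Prod.fst (Sum.inl_injective hq)) hpq

/-- A star position on a filled Bose construction: the conditions on the roles of the points of a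
block are checked for the blocks inside the filled groups and for those across the groups. -/
def boseStar (hh : 2 * h = 1) (ht : ∀ x y, t x y = t y x) (hF : ∀ f : F, f + f = 0)
    (hsub : ∀ x a b, (fill x).op (.inr a) (.inr b) = .inr (sub.op a b))
    (role : (R × ZMod 3 × F) ⊕ N → Role)
    (hgroup : ∀ x u v, u ≠ v → Role.Fits (role (groupIncl x u)) (role (groupIncl x v))
      (role (groupIncl x ((fill x).op u v))))
    (hcross : ∀ p q : R × ZMod 3 × F, p.1 ≠ q.1 →
      Role.Fits (role (.inl p)) (role (.inl q)) (role (.inl (boseThird h t p q))))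
    (hdead : ∀ z, role z = .dead →
      (∃ x u v, u ≠ v ∧ role (groupIncl x u) = .played ∧ role (groupIncl x v) = .played ∧
        groupIncl x ((fill x).op u v) = z) ∨
      (∃ p q : R × ZMod 3 × F, p.1 ≠ q.1 ∧ role (.inl p) = .played ∧ role (.inl q) = .played ∧
        .inl (boseThird h t p q) = z))
    (hcenter : ∃! z, role z = .center) :
    StarSystem ((R × ZMod 3 × F) ⊕ N) where
  toSteinerOp := boseSteinerOp hh ht hF hsub
  role := role
  fits u v huv := by
    change Role.Fits _ _ (role (boseOp h t sub fill u v))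
    rcases group_or_cross u v with ⟨x, u, v, rfl, rfl⟩ | ⟨p, q, hpq, rfl, rfl⟩
    · rw [boseOp_group hsub]
      exact hgroup x u v fun e => huv (by rw [e])
    · rw [boseOp_cross hpq]
      exact hcross p q hpq
  dead z hz := by
    rcases hdead z hz with ⟨x, u, v, huv, hu, hv, rfl⟩ | ⟨p, q, hpq, hp, hq, rfl⟩
    · exact ⟨_, _, fun e => huv (groupIncl_injective x e), hu, hv, boseOp_group hsub x u v⟩
    · exact ⟨_, _, fun e => hpq (congrArg Prod.fst (Sum.inl_injective e)), hp, hq,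
        boseOp_cross (sub := sub) hpq⟩
  center := hcenter

end Bose

/-! ### Stars from groups of twelve points -/

theorem two_mul_natCast_succ (m : ℕ) : 2 * ((m + 1 : ℕ) : ZMod (2 * m + 1)) = 1 := by
  have h0 : ((2 * m + 1 : ℕ) : ZMod (2 * m + 1)) = 0 := ZMod.natCast_self _
  push_cast at h0 ⊢
  linear_combination h0

/-- The elementary abelian group of order four, which indexes the copies of a point when each point
of Bose's construction is replaced by four. -/
abbrev Four : Type := ZMod 2 × ZMod 2

/-- The role of a copy of a point: the subgroup of order two is unplayable, the two points of its
other coset are played and a leaf. -/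
def fourRole (f : Four) : Role :=
  if f.1 = 0 then .dead else if f.2 = 0 then .played else .leaf

theorem fits_fourRole (f g e : Four) (he : e.1 = 0) :
    Role.Fits (fourRole f) (fourRole g) (fourRole (f + g + e)) := by
  revert f g e; decide

/-- A filling of a group of Bose's construction with its hole `Fin m`, in which the roles of the
points of the group are given by `fourRole` and those of the hole by `role`. -/
structure FourFill (m : ℕ) where
  sub : SteinerOp (Fin m)
  fill : SteinerOp ((ZMod 3 × Four) ⊕ Fin m)
  fill_sub : ∀ a b, fill.op (.inr a) (.inr b) = .inr (sub.op a b)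
  role : Fin m → Role
  fits : ∀ u v, u ≠ v → Role.Fits (Sum.elim (fun q => fourRole q.2) role u)
    (Sum.elim (fun q => fourRole q.2) role v)
    (Sum.elim (fun q => fourRole q.2) role (fill.op u v))
  dead : ∀ b, role b = .dead → ∃ u v, u ≠ v ∧
    Sum.elim (fun q => fourRole q.2) role u = .played ∧
    Sum.elim (fun q => fourRole q.2) role v = .played ∧ fill.op u v = .inr b
  center : ∃! b, role b = .center

namespace FourFill

variable {R : Type*} [CommRing R] [DecidableEq R] {m : ℕ} (d : FourFill m)

/-- The blocks through two points of a common level, one of them over `0`, are twisted: their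
elements of `Four` have the sum `(0, 1)` instead of `0`. Without the twist, two played points
`(1, 0)` would always have `(0, 0)` as their third point, and the copies `(0, 1)` would remain
available. -/
def twist (x y : R) : Four := if x = 0 ∨ y = 0 then (0, 1) else 0

theorem twist_comm (x y : R) : twist x y = twist y x := by
  simp only [twist, or_comm]

theorem twist_fst (x y : R) : (twist x y).1 = 0 := by
  unfold twist; split_ifs <;> rfl

theorem boseThird_snd (h : R) (p q : R × ZMod 3 × Four) :
    ∃ e : Four, e.1 = 0 ∧ (boseThird h twist p q).2.2 = p.2.2 + q.2.2 + e := by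
  unfold boseThird
  split_ifs
  · exact ⟨_, twist_fst _ _, rfl⟩
  · exact ⟨_, twist_fst _ _, rfl⟩
  · exact ⟨_, twist_fst _ _, rfl⟩

/-- The roles of all points of the construction. -/
def allRole : (R × ZMod 3 × Four) ⊕ Fin m → Role :=
  Sum.elim (fun p => fourRole p.2.2) d.role

omit [CommRing R] [DecidableEq R] in
theorem allRole_groupIncl (x : R) (u : (ZMod 3 × Four) ⊕ Fin m) :
    d.allRole (groupIncl x u) = Sum.elim (fun q => fourRole q.2) d.role u := by
  rcases u with u | u <;> rfl

/-- Each unplayable point of a group is the third point of two played points of other groups. -/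
theorem dead_cross [Nontrivial R] {h : R} (hh : 2 * h = 1) (z : R) (i : ZMod 3) (f : Four)
    (hf : fourRole f = .dead) :
    ∃ p q : R × ZMod 3 × Four, p.1 ≠ q.1 ∧ fourRole p.2.2 = .played ∧
      fourRole q.2.2 = .played ∧ boseThird h twist p q = (z, i, f) := by
  have two : ∀ w : R, 2 * w = 0 → w = 0 := fun w hw => by
    linear_combination h * hw - w * hh
  have hP : fourRole (1, 0) = .played := rfl
  -- a point of level `i` with another first coordinate than `z` lies in a block with `(z, i)`
  have key : ∀ x, x ≠ z → twist x z = f → ∃ p q : R × ZMod 3 × Four, p.1 ≠ q.1 ∧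
      fourRole p.2.2 = .played ∧ fourRole q.2.2 = .played ∧
      boseThird h twist p q = (z, i, f) := by
    intro x hx hxf
    refine ⟨(x, i, (1, 0)), (h * (x + z), i + 1, (1, 0)), fun e => hx ?_, hP, hP, ?_⟩
    · change x = h * (x + z) at e
      linear_combination 2 * e + (x + z) * hh
    · have e : 2 * (h * (x + z)) - x = z := by linear_combination (x + z) * hh
      rw [boseThird_next, e, hxf]
      have : ((1, 0) : Four) + (1, 0) = 0 := by decide
      rw [this, zero_add]
  have hcase : ∀ f, fourRole f = .dead → f = 0 ∨ f = (0, 1) := by decide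
  have hf' := hcase f hf
  by_cases hz : z = 0
  · rcases hf' with rfl | rfl
    · refine ⟨(1, i - 1, (1, 0)), (-1, i - 1, (1, 0)), fun e => one_ne_zero (α := R)
        (two 1 ?_), hP, hP, ?_⟩
      · change (1 : R) = -1 at e
        linear_combination e
      · rw [boseThird_same, hz]
        have e : twist (1 : R) (-1) = 0 := by simp [twist]
        rw [e]
        have : ((1, 0) : Four) + (1, 0) + 0 = 0 := by decide
        rw [this, add_neg_cancel, mul_zero, sub_add_cancel]
    · exact key 1 (by rw [hz]; exact one_ne_zero) (by simp [twist, hz])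
  · rcases hf' with rfl | rfl
    · refine key (-z) (fun e => hz (two z ?_)) (by simp [twist, hz])
      linear_combination -e
    · exact key 0 (Ne.symm hz) (by simp [twist])

/-- The star position of Bose's construction with groups of twelve points. -/
def star [Nontrivial R] {h : R} (hh : 2 * h = 1) : StarSystem ((R × ZMod 3 × Four) ⊕ Fin m) :=
  boseStar (sub := d.sub) (fill := fun _ => d.fill) hh twist_comm (by decide)
    (fun _ => d.fill_sub) d.allRole
    (by
      intro x u v huv
      simp only [allRole_groupIncl]
      exact d.fits u v huv)
    (by
      intro p q _
      obtain ⟨e, he, hpq⟩ := boseThird_snd h p q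
      change Role.Fits (fourRole p.2.2) (fourRole q.2.2) (fourRole (boseThird h twist p q).2.2)
      rw [hpq]
      exact fits_fourRole _ _ _ he)
    (by
      rintro (⟨z, i, f⟩ | b) hz
      · obtain ⟨p, q, hpq, hp, hq, e⟩ := dead_cross hh z i f hz
        exact .inr ⟨p, q, hpq, hp, hq, by rw [e]⟩
      · obtain ⟨u, v, huv, hu, hv, e⟩ := d.dead b hz
        refine .inl ⟨0, u, v, huv, ?_, ?_, ?_⟩
        · rw [allRole_groupIncl, hu]
        · rw [allRole_groupIncl, hv]
        · rw [e]; rfl)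
    (by
      obtain ⟨b, hb, hu⟩ := d.center
      refine ⟨.inr b, hb, ?_⟩
      rintro (⟨z, i, f⟩ | b') hb'
      · have : ∀ f, fourRole f ≠ .center := by decide
        exact absurd hb' (this f)
      · rw [hu b' hb'])

/-- The leaves are one copy of each point and the leaves of the hole. -/
def leafEquiv : {x : (R × ZMod 3 × Four) ⊕ Fin m // d.allRole x = .leaf} ≃
    (R × ZMod 3) ⊕ {b // d.role b = .leaf} :=
  Equiv.subtypeSum.trans (Equiv.sumCongr
    { toFun := fun p => (p.1.1, p.1.2.1)
      invFun := fun q => ⟨(q.1, q.2, (1, 1)), rfl⟩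
      left_inv := by
        rintro ⟨⟨x, i, f⟩, hf⟩
        have : ∀ f, fourRole f = .leaf → f = (1, 1) := by decide
        obtain rfl := this f hf
        rfl
      right_inv := fun _ => rfl }
    (Equiv.refl _))

/-- The orders reached with groups of twelve points. -/
theorem mem_starOrders {k r a v : ℕ} (hk : 1 ≤ k)
    (hr : Fintype.card {b // d.role b = .leaf} = r)
    (hv : v = 12 * (2 * k + 1) + m) (ha : a - 1 = 3 * (2 * k + 1) + r) : v ∈ starOrders a := by
  have : Fact (1 < 2 * k + 1) := ⟨by omega⟩
  refine (d.star (two_mul_natCast_succ k)).mem_starOrders ?_ ?_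
  · simp [Fintype.card_sum, Fintype.card_prod, ZMod.card, hv]; ring
  · refine (Fintype.card_congr (d.leafEquiv (R := ZMod (2 * k + 1)))).trans ?_
    rw [Fintype.card_sum, hr, Fintype.card_prod, ZMod.card, ZMod.card, ha, mul_comm]

end FourFill

/-! ### The fillings of the groups of twelve points -/

/-- The number of a point of a filled group in the operation tables. -/
def fourCode {m : ℕ} : (ZMod 3 × Four) ⊕ Fin m → ℕ
  | .inl (i, f, g) => 4 * i.val + 2 * f.val + g.val
  | .inr a => 12 + a.val

/-- The point of a filled group with a given number. -/
def fourPoint (m : ℕ) [NeZero m] (k : ℕ) : (ZMod 3 × Four) ⊕ Fin m :=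
  if k < 12 then .inl ((k / 4 : ℕ), (k / 2 : ℕ), (k : ℕ)) else .inr (Fin.ofNat m (k - 12))

/-- The entry of an operation table. -/
def tableOp (l : List (List ℕ)) (x y : ℕ) : ℕ := (l.getD x []).getD y 0

/-- A Steiner triple system of order 13 in which the points `2, 3, 6, 7, 10, 11` contain no block
and are paired by the blocks through the point 12. -/
def table13 : List (List ℕ) := [
  [0, 3, 10, 1, 8, 6, 5, 11, 4, 12, 2, 7, 9],
  [3, 1, 8, 0, 12, 9, 11, 10, 2, 5, 7, 6, 4],
  [10, 8, 2, 12, 6, 11, 4, 9, 1, 7, 0, 5, 3],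
  [1, 0, 12, 3, 11, 10, 9, 8, 7, 6, 5, 4, 2],
  [8, 12, 6, 11, 4, 7, 2, 5, 0, 10, 9, 3, 1],
  [6, 9, 11, 10, 7, 5, 0, 4, 12, 1, 3, 2, 8],
  [5, 11, 4, 9, 2, 0, 6, 12, 10, 3, 8, 1, 7],
  [11, 10, 9, 8, 5, 4, 12, 7, 3, 2, 1, 0, 6],
  [4, 2, 1, 7, 0, 12, 10, 3, 8, 11, 6, 9, 5],
  [12, 5, 7, 6, 10, 1, 3, 2, 11, 9, 4, 8, 0],
  [2, 7, 0, 5, 9, 3, 8, 1, 6, 4, 10, 12, 11],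
  [7, 6, 5, 4, 3, 2, 1, 0, 9, 8, 12, 11, 10],
  [9, 4, 3, 2, 1, 8, 7, 6, 5, 0, 11, 10, 12]]

/-- A Steiner triple system of order 21 with a subsystem of order 9 on the points from 12 on. -/
def table21 : List (List ℕ) := [
  [0, 12, 11, 18, 19, 20, 14, 13, 17, 16, 15, 2, 1, 7, 6, 10, 9, 8, 3, 4, 5],
  [12, 1, 14, 17, 5, 4, 18, 20, 16, 19, 13, 15, 0, 10, 2, 11, 8, 3, 6, 9, 7],
  [11, 14, 2, 12, 20, 15, 17, 19, 13, 18, 16, 0, 3, 8, 1, 5, 10, 6, 9, 7, 4],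
  [18, 17, 12, 3, 15, 14, 8, 16, 6, 13, 20, 19, 2, 9, 5, 4, 7, 1, 0, 11, 10],
  [19, 5, 20, 15, 4, 1, 16, 14, 12, 17, 18, 13, 8, 11, 7, 3, 6, 9, 10, 0, 2],
  [20, 4, 15, 14, 1, 5, 13, 18, 19, 12, 17, 16, 9, 6, 3, 2, 11, 10, 7, 8, 0],
  [14, 18, 17, 8, 16, 13, 6, 12, 3, 15, 19, 20, 7, 5, 0, 9, 4, 2, 1, 10, 11],
  [13, 20, 19, 16, 14, 18, 12, 7, 15, 10, 9, 17, 6, 0, 4, 8, 3, 11, 5, 2, 1],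
  [17, 16, 13, 6, 12, 19, 3, 15, 8, 20, 14, 18, 4, 2, 10, 7, 1, 0, 11, 5, 9],
  [16, 19, 18, 13, 17, 12, 15, 10, 20, 9, 7, 14, 5, 3, 11, 6, 0, 4, 2, 1, 8],
  [15, 13, 16, 20, 18, 17, 19, 9, 14, 7, 10, 12, 11, 1, 8, 0, 2, 5, 4, 6, 3],
  [2, 15, 0, 19, 13, 16, 20, 17, 18, 14, 12, 11, 10, 4, 9, 1, 5, 7, 8, 3, 6],
  [1, 0, 3, 2, 8, 9, 7, 6, 4, 5, 11, 10, 12, 14, 13, 18, 20, 19, 15, 17, 16],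
  [7, 10, 8, 9, 11, 6, 5, 0, 2, 3, 1, 4, 14, 13, 12, 20, 19, 18, 17, 16, 15],
  [6, 2, 1, 5, 7, 3, 0, 4, 10, 11, 8, 9, 13, 12, 14, 19, 18, 20, 16, 15, 17],
  [10, 11, 5, 4, 3, 2, 9, 8, 7, 6, 0, 1, 18, 20, 19, 15, 17, 16, 12, 14, 13],
  [9, 8, 10, 7, 6, 11, 4, 3, 1, 0, 2, 5, 20, 19, 18, 17, 16, 15, 14, 13, 12],
  [8, 3, 6, 1, 9, 10, 2, 11, 0, 4, 5, 7, 19, 18, 20, 16, 15, 17, 13, 12, 14],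
  [3, 6, 9, 0, 10, 7, 1, 5, 11, 2, 4, 8, 15, 17, 16, 12, 14, 13, 18, 20, 19],
  [4, 9, 7, 11, 0, 8, 10, 2, 5, 1, 6, 3, 17, 16, 15, 14, 13, 12, 20, 19, 18],
  [5, 7, 4, 10, 2, 0, 11, 1, 9, 8, 3, 6, 16, 15, 17, 13, 12, 14, 19, 18, 20]]

/-- The affine plane of order three. -/
def affinePlane : SteinerOp (Fin 9) where
  op x y := Fin.ofNat 9 ((6 - x.val / 3 - y.val / 3) % 3 * 3 + (6 - x.val % 3 - y.val % 3) % 3)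
  comm := by decide +kernel
  op_op := by decide +kernel
  idem := by decide +kernel

/-- The point of the list `l` whose label is the sum of the labels of `x` and `y`, for labels that
are binary vectors. -/
def xorThird {V : Type*} (l : List V) (label : V → ℕ) (x y : V) : V :=
  (l.find? fun z => label z == label x ^^^ label y).getD x

/-- The labels of the points of the projective space of dimension 3 over the field with two
elements: the hole is a line, and the center of the star and the unplayable points form a
hyperplane. -/
def spaceLabel : (ZMod 3 × Four) ⊕ Fin 3 → ℕ
  | .inl (i, f, g) => 4 * (i.val + 1) + 2 * f.val + g.val
  | .inr a => a.val + 1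

/-- The filling with one further point, the center. -/
def fourFill1 : FourFill 1 where
  sub := ⟨fun _ _ => 0, by decide, by decide, by decide⟩
  fill :=
    { op := fun x y => fourPoint 1 (tableOp table13 (fourCode x) (fourCode y))
      comm := by decide +kernel
      op_op := by decide +kernel
      idem := by decide +kernel }
  fill_sub := by decide +kernel
  role _ := .center
  fits := by decide +kernel
  dead := by decide
  center := ⟨0, rfl, by decide⟩

/-- The filling with a block that consists of the center, a played point and a leaf. -/
def fourFill3 : FourFill 3 where
  sub := ⟨fun x y => -(x + y), by decide, by decide, by decide⟩
  fill :=
    { op := xorThird ((List.range 15).map (fourPoint 3)) spaceLabel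
      comm := by decide +kernel
      op_op := by decide +kernel
      idem := by decide +kernel }
  fill_sub := by decide +kernel
  role := ![.center, .played, .leaf]
  fits := by decide +kernel
  dead := by decide
  center := ⟨0, rfl, by decide⟩

/-- The filling with an affine plane of order three that contains the center, two played points,
two leaves and four unplayable points. -/
def fourFill9 : FourFill 9 where
  sub := affinePlane
  fill :=
    { op := fun x y => fourPoint 9 (tableOp table21 (fourCode x) (fourCode y))
      comm := by decide +kernel
      op_op := by decide +kernel
      idem := by decide +kernel }
  fill_sub := by decide +kernel
  role := ![.center, .played, .leaf, .played, .dead, .dead, .leaf, .dead, .dead]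
  fits := by decide +kernel
  dead := by decide +kernel
  center := ⟨0, rfl, by decide⟩

theorem mem_starOrders_of_mod_four {a : ℕ} (ha : 9 ≤ a) (h : a % 6 = 4) :
    4 * a - 3 ∈ starOrders a :=
  fourFill1.mem_starOrders (k := a / 6) (r := 0) (by omega) (by decide) (by omega) (by omega)

theorem mem_starOrders_of_mod_five {a : ℕ} (ha : 9 ≤ a) (h : a % 6 = 5) :
    4 * a - 5 ∈ starOrders a :=
  fourFill3.mem_starOrders (k := a / 6) (r := 1) (by omega) (by decide) (by omega) (by omega)

theorem mem_starOrders_of_mod_zero {a : ℕ} (ha : 9 ≤ a) (h : a % 6 = 0) :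
    4 * a - 3 ∈ starOrders a :=
  fourFill9.mem_starOrders (k := a / 6 - 1) (r := 2) (by omega) (by decide) (by omega) (by omega)

/-! ### Stars from groups of six points -/

/-- The role of a point in the construction with groups of six points and one further point. The
copies `(x, i, 0)`, called first copies, are unplayable except for the center `(0, 0, 0)`. The
blocks through the center and two other groups pair the second copies `(x, i, 1)`, and each pair
has to consist of a played point and a leaf: in level `2` the points over `x` and `-x` are paired,
and those with `x = 1, ..., m` are played; the points `(2 y, 0, 1)` and `(y, 1, 1)` are paired, and
the former is played unless `y = 1`. In the group of the center two second copies are played; `α`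
is the role of the third one and `β` that of the further point. -/
def sixRole (m : ℕ) (α β : Role) :
    (ZMod (2 * m + 1) × ZMod 3 × ZMod 2) ⊕ Fin 1 → Role
  | .inl (x, i, f) =>
    if f = 0 then (if x = 0 ∧ i = 0 then .center else .dead)
    else if x = 0 then (if i = 2 then α else .played)
    else if i = 0 then (if x = 2 then .leaf else .played)
    else if i = 1 then (if x = 1 then .played else .leaf)
    else if x.val ≤ m then .played else .leaf
  | .inr _ => β

/-- The roles in the group of the center, the group over `0`. -/
def sixGroupRole (α β : Role) : (ZMod 3 × ZMod 2) ⊕ Fin 1 → Role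
  | .inl (i, f) => if f = 0 then (if i = 0 then .center else .dead)
    else if i = 2 then α else .played
  | .inr _ => β

/-- The points of a group of six points and the further point. They become a Fano plane when they
are labelled with the non-zero binary vectors of length three. -/
def fanoPoints : List ((ZMod 3 × ZMod 2) ⊕ Fin 1) :=
  [.inl (0, 0), .inl (0, 1), .inl (1, 0), .inl (1, 1), .inl (2, 0), .inl (2, 1), .inr 0]

/-- The labelling of a group of six points and the further point by the entries of a list. -/
def fanoLabel (l : List ℕ) : (ZMod 3 × ZMod 2) ⊕ Fin 1 → ℕ
  | .inl (i, f) => l.getD (2 * i.val + f.val) 0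
  | .inr _ => l.getD 6 0

/-- The Fano plane in which the first copies of the points form a line. -/
def fanoLine : SteinerOp ((ZMod 3 × ZMod 2) ⊕ Fin 1) where
  op := xorThird fanoPoints (fanoLabel [1, 5, 2, 6, 3, 7, 4])
  comm := by decide +kernel
  op_op := by decide +kernel
  idem := by decide +kernel

/-- A filling of the group of the center for a star with a leaf in this group. -/
def fanoOneLeaf : SteinerOp ((ZMod 3 × ZMod 2) ⊕ Fin 1) where
  op := xorThird fanoPoints (fanoLabel [5, 1, 6, 2, 7, 4, 3])
  comm := by decide +kernel
  op_op := by decide +kernel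
  idem := by decide +kernel

/-- A filling of the group of the center for a star without leaves in this group. -/
def fanoNoLeaf : SteinerOp ((ZMod 3 × ZMod 2) ⊕ Fin 1) where
  op := xorThird fanoPoints (fanoLabel [7, 1, 5, 2, 6, 4, 3])
  comm := by decide +kernel
  op_op := by decide +kernel
  idem := by decide +kernel

/-- A filling of the group of the center and the further point, with the role `α` of the second copy
in level `2` and the role `β` of the further point. Unplayable first copies need no pair of played
points within the filling, since they are reached from other groups. -/
structure SixFill where
  α : Role
  β : Role
  fill : SteinerOp ((ZMod 3 × ZMod 2) ⊕ Fin 1)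
  fits : ∀ u v, u ≠ v → Role.Fits (sixGroupRole α β u) (sixGroupRole α β v)
    (sixGroupRole α β (fill.op u v))
  dead : ∀ u, sixGroupRole α β u = .dead → (∃ i, u = .inl (i, 0)) ∨
    ∃ p q, p ≠ q ∧ sixGroupRole α β p = .played ∧ sixGroupRole α β q = .played ∧ fill.op p q = u
  α_ne : α ≠ .center
  β_ne : β ≠ .center

/-- The filling of the group of the center for two leaves in this group and the hole. -/
def sixFillTwo : SixFill :=
  ⟨.leaf, .leaf, fanoLine, by decide +kernel, by decide +kernel, by decide, by decide⟩

/-- The filling of the group of the center for one leaf in this group and the hole. -/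
def sixFillOne : SixFill :=
  ⟨.leaf, .dead, fanoOneLeaf, by decide +kernel, by decide +kernel, by decide, by decide⟩

/-- The filling of the group of the center for no leaf in this group and the hole. -/
def sixFillZero : SixFill :=
  ⟨.played, .dead, fanoNoLeaf, by decide +kernel, by decide +kernel, by decide, by decide⟩

namespace SixFill

theorem zmod_two_cases (f : ZMod 2) : f = 0 ∨ f = 1 := by revert f; decide

theorem zmod_three_cases (i : ZMod 3) : i = 0 ∨ i = 0 + 1 ∨ i = 2 := by revert i; decide

variable {m : ℕ} (d : SixFill)

/-- The roles of all points of the construction. -/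
abbrev role (m : ℕ) := sixRole m d.α d.β

theorem groupRole (u : (ZMod 3 × ZMod 2) ⊕ Fin 1) :
    d.role m (groupIncl 0 u) = sixGroupRole d.α d.β u := by
  rcases u with ⟨i, f⟩ | u <;> simp [role, groupIncl, sixRole, sixGroupRole]

theorem role_zero (x : ZMod (2 * m + 1)) (i : ZMod 3) :
    d.role m (.inl (x, i, 0)) = if x = 0 ∧ i = 0 then .center else .dead := by
  simp [role, sixRole]

theorem role_one_ne {x : ZMod (2 * m + 1)} {i : ZMod 3} :
    d.role m (.inl (x, i, 1)) ≠ .center := by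
  have := d.α_ne
  simp only [role, sixRole]
  split_ifs <;> simp_all

theorem fits_of_dead {r s t : Role} (hr : r ≠ .center) (hs : s ≠ .center)
    (h : r = .dead ∨ s = .dead ∨ t = .dead) : Role.Fits r s t := by
  cases r <;> cases s <;> cases t <;> simp_all [Role.Fits]

theorem val_neg_le {x : ZMod (2 * m + 1)} (hx : x ≠ 0) : (-x).val ≤ m ↔ ¬ x.val ≤ m := by
  have := NeZero.mk hx
  rw [ZMod.val_neg_of_ne_zero]
  have h1 := ZMod.val_lt x
  have h2 : x.val ≠ 0 := fun h => hx ((ZMod.val_eq_zero x).1 h)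
  omega

theorem role_level_zero {x : ZMod (2 * m + 1)} (hx : x ≠ 0) :
    d.role m (.inl (x, 0, 1)) = if x = 2 then .leaf else .played := by
  simp [role, sixRole, hx]

theorem role_level_one {x : ZMod (2 * m + 1)} (hx : x ≠ 0) :
    d.role m (.inl (x, 1, 1)) = if x = 1 then .played else .leaf := by
  simp [role, sixRole, hx]

theorem role_level_two {x : ZMod (2 * m + 1)} (hx : x ≠ 0) :
    d.role m (.inl (x, 2, 1)) = if x.val ≤ m then .played else .leaf := by
  have h1 : (2 : ZMod 3) ≠ 0 := by decide
  have h2 : (2 : ZMod 3) ≠ 1 := by decide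
  simp [role, sixRole, hx, h1, h2]

theorem played_level_zero {x : ZMod (2 * m + 1)} (hx : x ≠ 2) :
    d.role m (.inl (x, 0, 1)) = .played := by
  by_cases h : x = 0
  · have h1 : (0 : ZMod 3) ≠ 2 := by decide
    simp [role, sixRole, h, h1]
  · rw [d.role_level_zero h, if_neg hx]

theorem played_level_one {x : ZMod (2 * m + 1)} (hx : x = 0 ∨ x = 1) :
    d.role m (.inl (x, 1, 1)) = .played := by
  by_cases h : x = 0
  · have h1 : (1 : ZMod 3) ≠ 2 := by decide
    simp [role, sixRole, h, h1]
  · rw [d.role_level_one h, if_pos (hx.resolve_left h)]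

/-- Across groups, each block through the center contains one played point and one leaf. -/
theorem center_cross {y : ZMod (2 * m + 1)} (hy : y ≠ 0) (j : ZMod 3) :
    ∃ r, boseThird ((m + 1 : ℕ) : ZMod (2 * m + 1)) (fun _ _ => (0 : ZMod 2)) (0, 0, 0) (y, j, 1) =
        r ∧
      ((d.role m (.inl (y, j, 1)) = .leaf ∧ d.role m (.inl r) = .played) ∨
        (d.role m (.inl (y, j, 1)) = .played ∧ d.role m (.inl r) = .leaf)) := by
  have hh := two_mul_natCast_succ m
  generalize ((m + 1 : ℕ) : ZMod (2 * m + 1)) = h at hh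
  refine ⟨_, rfl, ?_⟩
  have hj := zmod_three_cases j
  rcases hj with rfl | rfl | rfl
  · have e1 : h * (0 + y) ≠ 0 := fun e => hy (by linear_combination 2 * e - y * hh)
    have e2 : h * (0 + y) = 1 ↔ y = 2 :=
      ⟨fun e => by linear_combination 2 * e - y * hh, fun e => by
        rw [e]; linear_combination hh⟩
    rw [boseThird_same, zero_add (1 : ZMod 3), zero_add (1 : ZMod 2), add_zero,
      d.role_level_zero hy, d.role_level_one e1]
    simp only [e2]
    split_ifs <;> simp
  · have e1 : 2 * y - 0 ≠ 0 := fun e => hy (by linear_combination h * e - y * hh)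
    have e2 : 2 * y - 0 = 2 ↔ y = 1 :=
      ⟨fun e => by linear_combination h * e - (y - 1) * hh, fun e => by rw [e]; ring⟩
    rw [boseThird_next, zero_add (1 : ZMod 3), zero_add (1 : ZMod 2), add_zero,
      d.role_level_one hy, d.role_level_zero e1]
    simp only [e2]
    split_ifs <;> simp
  · have e0 : (0 : ZMod 3) = 2 + 1 := by decide
    have e1 : 2 * 0 - y = -y := by ring
    rw [e0, boseThird_prev, e1, zero_add (1 : ZMod 2), add_zero, d.role_level_two hy,
      d.role_level_two (neg_ne_zero.2 hy)]
    simp only [val_neg_le hy]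
    split_ifs <;> simp

theorem natCast_ne_zero {k : ℕ} (h1 : k ≠ 0) (h2 : k < 2 * m + 1) :
    (k : ZMod (2 * m + 1)) ≠ 0 := by
  rw [ne_eq, ZMod.natCast_eq_zero_iff]
  exact fun h => h1 (Nat.eq_zero_of_dvd_of_lt h h2)

/-- Each first copy of a point other than the center is the third point of two played points of
other groups. -/
theorem dead_cross (hm : 3 ≤ m) (x : ZMod (2 * m + 1)) (i : ZMod 3) (hx : ¬ (x = 0 ∧ i = 0)) :
    ∃ p q : ZMod (2 * m + 1) × ZMod 3 × ZMod 2, p.1 ≠ q.1 ∧ d.role m (.inl p) = .played ∧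
      d.role m (.inl q) = .played ∧
      boseThird ((m + 1 : ℕ) : ZMod (2 * m + 1)) (fun _ _ => (0 : ZMod 2)) p q = (x, i, 0) := by
  have n1 : (1 : ZMod (2 * m + 1)) ≠ 0 := by
    exact_mod_cast natCast_ne_zero (m := m) (k := 1) (by norm_num) (by omega)
  have n2 : (2 : ZMod (2 * m + 1)) ≠ 0 := by
    exact_mod_cast natCast_ne_zero (m := m) (k := 2) (by norm_num) (by omega)
  have n3 : (3 : ZMod (2 * m + 1)) ≠ 0 := by
    exact_mod_cast natCast_ne_zero (m := m) (k := 3) (by norm_num) (by omega)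
  have n4 : (4 : ZMod (2 * m + 1)) ≠ 0 := by
    exact_mod_cast natCast_ne_zero (m := m) (k := 4) (by norm_num) (by omega)
  have v1 : (1 : ZMod (2 * m + 1)).val ≤ m := by
    have := ZMod.val_natCast_of_lt (n := 2 * m + 1) (a := 1) (by omega)
    rw [Nat.cast_one] at this; omega
  have v2 : (2 : ZMod (2 * m + 1)).val ≤ m := by
    have := ZMod.val_natCast_of_lt (n := 2 * m + 1) (a := 2) (by omega)
    rw [Nat.cast_ofNat] at this; omega
  have hh := two_mul_natCast_succ m
  generalize ((m + 1 : ℕ) : ZMod (2 * m + 1)) = h at hh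
  have o : (1 : ZMod 2) + 1 + 0 = 0 := by decide
  have hi := zmod_three_cases i
  rcases hi with rfl | rfl | rfl
  · -- the point `(0, 1, 1)` and the point `(-x, 0, 1)`, unless the latter is the leaf of level `0`
    have hx0 : x ≠ 0 := fun e => hx ⟨e, rfl⟩
    by_cases h2 : x = -2
    · refine ⟨(4, 0, 1), (1, 0 + 1, 1), fun e => n3 ?_, d.played_level_zero fun e => n2 ?_,
        d.played_level_one (.inr rfl), ?_⟩
      · change (4 : ZMod (2 * m + 1)) = 1 at e
        linear_combination e
      · linear_combination e
      · rw [boseThird_next, o, h2]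
        congr 1; ring
    · refine ⟨(-x, 0, 1), (0, 0 + 1, 1), neg_ne_zero.2 hx0,
        d.played_level_zero fun e => h2 (by rw [← e, neg_neg]),
        d.played_level_one (.inl rfl), ?_⟩
      rw [boseThird_next, o]
      congr 1; ring
  · -- two points of level `0` that differ from the leaf over `2`
    have key : ∀ e : ZMod (2 * m + 1), 2 * e ≠ 0 → x + e ≠ 2 → x - e ≠ 2 → ∃ p q :
        ZMod (2 * m + 1) × ZMod 3 × ZMod 2, p.1 ≠ q.1 ∧ d.role m (.inl p) = .played ∧
        d.role m (.inl q) = .played ∧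
        boseThird h (fun _ _ => (0 : ZMod 2)) p q = (x, 0 + 1, 0) := by
      intro e h1 h2 h3
      refine ⟨(x + e, 0, 1), (x - e, 0, 1), fun h => h1 ?_, d.played_level_zero h2,
        d.played_level_zero h3, ?_⟩
      · change x + e = x - e at h
        linear_combination h
      · rw [boseThird_same, o]
        congr 1
        linear_combination x * hh
    by_cases hx13 : x = 1 ∨ x = 3
    · refine key 2 (fun e => n4 (by linear_combination e)) ?_ ?_
      · rcases hx13 with rfl | rfl
        · exact fun e => n1 (by linear_combination e)
        · exact fun e => n3 (by linear_combination e)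
      · rcases hx13 with rfl | rfl
        · exact fun e => n3 (by linear_combination -e)
        · exact fun e => n1 (by linear_combination -e)
    · push Not at hx13
      refine key 1 (by rwa [mul_one]) (fun e => hx13.1 (by linear_combination e))
        (fun e => hx13.2 (by linear_combination e))
  · -- a played point of level `2`, over `1` or `2`, and one of level `0` other than its leaf
    have key : ∀ y : ZMod (2 * m + 1), y ≠ 0 → y.val ≤ m → y ≠ x → x + y ≠ 4 → ∃ p q :
        ZMod (2 * m + 1) × ZMod 3 × ZMod 2, p.1 ≠ q.1 ∧ d.role m (.inl p) = .played ∧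
        d.role m (.inl q) = .played ∧
        boseThird h (fun _ _ => (0 : ZMod 2)) p q = (x, 2, 0) := by
      intro y h0 h1 h2 h3
      have e0 : (0 : ZMod 3) = 2 + 1 := by decide
      refine ⟨(y, 2, 1), (h * (x + y), 0, 1), fun e => h2 ?_,
        by rw [d.role_level_two h0, if_pos h1], d.played_level_zero fun e => h3 ?_, ?_⟩
      · change y = h * (x + y) at e
        linear_combination 2 * e + (x + y) * hh
      · linear_combination 2 * e - (x + y) * hh
      · rw [e0, boseThird_next, o]
        congr 1
        linear_combination (x + y) * hh
    by_cases hx13 : x = 1 ∨ x = 3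
    · refine key 2 n2 v2 ?_ ?_
      · rcases hx13 with rfl | rfl
        · exact fun e => n1 (by linear_combination e)
        · exact fun e => n1 (by linear_combination -e)
      · rcases hx13 with rfl | rfl
        · exact fun e => n1 (by linear_combination -e)
        · exact fun e => n1 (by linear_combination e)
    · push Not at hx13
      exact key 1 n1 v1 hx13.1.symm fun e => hx13.2 (by linear_combination e)

/-- The first copies of the points of a group. -/
def isFirst : (ZMod 3 × ZMod 2) ⊕ Fin 1 → Bool
  | .inl q => q.2 = 0
  | .inr _ => false

/-- Each line of the Fano plane meets the line of the first copies. -/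
theorem line_cases (u v : (ZMod 3 × ZMod 2) ⊕ Fin 1) (h : u ≠ v) :
    isFirst u = true ∨ isFirst v = true ∨ isFirst (fanoLine.op u v) = true := by
  revert u v; decide +kernel

theorem snd_boseThird (h : ZMod (2 * m + 1)) (p q : ZMod (2 * m + 1) × ZMod 3 × ZMod 2) :
    (boseThird h (fun _ _ => (0 : ZMod 2)) p q).2.2 = p.2.2 + q.2.2 := by
  unfold boseThird
  split_ifs <;> exact add_zero _

theorem role_fst_ne {x : ZMod (2 * m + 1)} (hx : x ≠ 0) (u : (ZMod 3 × ZMod 2) ⊕ Fin 1) :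
    d.role m (groupIncl x u) ≠ .center := by
  rcases u with ⟨i, f⟩ | u
  · have hf := zmod_two_cases f
    change d.role m (.inl (x, i, f)) ≠ .center
    rcases hf with rfl | rfl
    · rw [d.role_zero]; simp [hx]
    · exact d.role_one_ne
  · exact d.β_ne

theorem fits_cross (p q : ZMod (2 * m + 1) × ZMod 3 × ZMod 2) (hpq : p.1 ≠ q.1) :
    Role.Fits (d.role m (.inl p)) (d.role m (.inl q)) (d.role m (.inl (boseThird
      ((m + 1 : ℕ) : ZMod (2 * m + 1)) (fun _ _ => (0 : ZMod 2)) p q))) := by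
  have hsnd := snd_boseThird ((m + 1 : ℕ) : ZMod (2 * m + 1)) p q
  have hne := boseThird_ne (t := fun _ _ => (0 : ZMod 2)) (two_mul_natCast_succ m) hpq
  have hinv := boseThird_boseThird (t := fun _ _ => (0 : ZMod 2)) (two_mul_natCast_succ m)
    (fun _ _ => rfl) (by decide) p q
  generalize hr : boseThird ((m + 1 : ℕ) : ZMod (2 * m + 1)) (fun _ _ => (0 : ZMod 2)) p q = r
    at hsnd hne hinv ⊢
  obtain ⟨x, i, f⟩ := p
  obtain ⟨y, j, g⟩ := q
  obtain ⟨z, l, e⟩ := r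
  change x ≠ y at hpq
  change x ≠ z at hne
  change e = f + g at hsnd
  rcases zmod_two_cases f with rfl | rfl <;> rcases zmod_two_cases g with rfl | rfl
  · rw [d.role_zero, d.role_zero]
    by_cases hx : x = 0 ∧ i = 0
    · rw [if_pos hx, if_neg fun hy => hpq (hx.1.trans hy.1.symm)]; trivial
    · rw [if_neg hx]; trivial
  · rw [d.role_zero]
    by_cases hx : x = 0 ∧ i = 0
    · obtain ⟨rfl, rfl⟩ := hx
      obtain ⟨r, hr', h⟩ := d.center_cross hpq.symm j
      rw [hr] at hr'
      rw [if_pos ⟨rfl, rfl⟩]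
      rw [← hr'] at h
      rcases h with ⟨h1, h2⟩ | ⟨h1, h2⟩
      · rw [h1]; exact h2
      · rw [h1]; trivial
    · rw [if_neg hx]; trivial
  · have h1 : d.role m (.inl (x, i, 1)) ≠ .center := d.role_one_ne
    rw [d.role_zero]
    generalize d.role m (.inl (x, i, 1)) = r at h1
    split_ifs <;> cases r <;> simp_all [Role.Fits]
  · -- two second copies: their third point is unplayable or the center
    have e0 : (1 : ZMod 2) + 1 = 0 := by decide
    rw [e0] at hsnd
    subst hsnd
    by_cases hz : z = 0 ∧ l = 0
    · obtain ⟨rfl, rfl⟩ := hz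
      obtain ⟨r, hr', h⟩ := d.center_cross hne i
      rw [boseThird_comm fun _ _ => rfl, hinv] at hr'
      rw [← hr'] at h
      rcases h with ⟨h1, h2⟩ | ⟨h1, h2⟩ <;> rw [h1, h2] <;> trivial
    · exact fits_of_dead d.role_one_ne d.role_one_ne (.inr (.inr (by
        rw [d.role_zero, if_neg hz])))

/-- The star position of Bose's construction with groups of six points. -/
def star (hm : 3 ≤ m) : StarSystem ((ZMod (2 * m + 1) × ZMod 3 × ZMod 2) ⊕ Fin 1) :=
  boseStar (sub := ⟨fun _ _ => 0, by decide, by decide, by decide⟩)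
    (fill := fun x => if x = 0 then d.fill else fanoLine)
    (t := fun _ _ => (0 : ZMod 2)) (two_mul_natCast_succ m) (fun _ _ => rfl) (by decide)
    (by
      intro x a b
      rw [Subsingleton.elim a 0, Subsingleton.elim b 0, SteinerOp.idem])
    (d.role m)
    (by
      intro x u v huv
      by_cases hx : x = 0
      · subst hx
        simp only [groupRole, if_true]
        exact d.fits u v huv
      · rw [if_neg hx]
        have hdead : ∀ w, isFirst w = true → d.role m (groupIncl x w) = .dead := by
          rintro (⟨i, f⟩ | b) hw
          · obtain rfl : f = 0 := by simpa [isFirst] using hw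
            change d.role m (.inl (x, i, 0)) = .dead
            rw [d.role_zero, if_neg fun h => hx h.1]
          · cases hw
        exact fits_of_dead (d.role_fst_ne hx u) (d.role_fst_ne hx v)
          ((line_cases u v huv).imp (hdead _) (Or.imp (hdead _) (hdead _))))
    d.fits_cross
    (by
      -- the remaining unplayable points: second copies over `0` and the further point
      have key : ∀ u, (∀ i, u ≠ .inl (i, 0)) → d.role m (groupIncl 0 u) = .dead →
          ∃ x u' v', u' ≠ v' ∧ d.role m (groupIncl x u') = .played ∧
            d.role m (groupIncl x v') = .played ∧
            groupIncl x ((if x = 0 then d.fill else fanoLine).op u' v') = groupIncl 0 u := by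
        intro u hu h
        rw [d.groupRole] at h
        rcases d.dead u h with ⟨i, hi⟩ | ⟨p, q, hpq, hp, hq, h⟩
        · exact absurd hi (hu i)
        · exact ⟨0, p, q, hpq, by rwa [d.groupRole], by rwa [d.groupRole], by
            rw [if_pos rfl, h]⟩
      rintro (⟨x, i, f⟩ | b) hz
      · have hf := zmod_two_cases f
        rcases hf with rfl | rfl
        · obtain ⟨p, q, h1, h2, h3, h4⟩ := d.dead_cross hm x i (by
            intro h
            rw [d.role_zero, if_pos h] at hz
            cases hz)
          exact .inr ⟨p, q, h1, h2, h3, by rw [h4]⟩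
        · by_cases hx : x = 0
          · subst hx
            exact .inl (key (.inl (i, 1)) (by simp) hz)
          · have hi : i = 0 ∨ i = 1 ∨ i = 2 := zmod_three_cases i
            rcases hi with rfl | rfl | rfl
            · rw [d.role_level_zero hx] at hz; split_ifs at hz
            · rw [d.role_level_one hx] at hz; split_ifs at hz
            · rw [d.role_level_two hx] at hz; split_ifs at hz
      · exact .inl (key (.inr b) (by simp) hz))
    (by
      refine ⟨.inl (0, 0, 0), by simp [role_zero], ?_⟩
      rintro (⟨x, i, f⟩ | b) hz
      · have hf := zmod_two_cases f
        rcases hf with rfl | rfl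
        · have hz' : d.role m (.inl (x, i, 0)) = .center := hz
          rw [d.role_zero] at hz'
          split_ifs at hz' with h
          rw [h.1, h.2]
        · exact absurd hz d.role_one_ne
      · exact absurd hz d.β_ne)

theorem card_leaf_level_zero (hm : 3 ≤ m) :
    (Finset.univ.filter fun x => d.role m (.inl (x, 0, 1)) = .leaf).card = 1 := by
  have n2 : (2 : ZMod (2 * m + 1)) ≠ 0 := by
    exact_mod_cast natCast_ne_zero (m := m) (k := 2) (by norm_num) (by omega)
  rw [Finset.card_eq_one]
  refine ⟨2, ?_⟩
  ext x
  simp only [Finset.mem_filter, Finset.mem_univ, true_and, Finset.mem_singleton]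
  constructor
  · intro h
    by_contra hx
    rw [d.played_level_zero hx] at h
    cases h
  · rintro rfl
    rw [d.role_level_zero n2, if_pos rfl]

theorem card_leaf_level_one (hm : 3 ≤ m) :
    (Finset.univ.filter fun x => d.role m (.inl (x, 1, 1)) = .leaf).card = 2 * m - 1 := by
  have n1 : (1 : ZMod (2 * m + 1)) ≠ 0 := by
    exact_mod_cast natCast_ne_zero (m := m) (k := 1) (by norm_num) (by omega)
  have : (Finset.univ.filter fun x => d.role m (.inl (x, 1, 1)) = .leaf) =
      ({0, 1} : Finset (ZMod (2 * m + 1)))ᶜ := by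
    ext x
    simp only [Finset.mem_filter, Finset.mem_univ, true_and, Finset.mem_compl,
      Finset.mem_insert, Finset.mem_singleton]
    constructor
    · intro h hx
      rw [d.played_level_one hx] at h
      cases h
    · intro hx
      push Not at hx
      rw [d.role_level_one hx.1, if_neg hx.2]
  rw [this, Finset.card_compl, Finset.card_pair n1.symm, ZMod.card]
  omega

theorem card_lt_val (m : ℕ) :
    (Finset.univ.filter fun x : ZMod (2 * m + 1) => m < x.val).card = m := by
  have : (Finset.univ.filter fun x : Fin (2 * m + 1) => m < x.val) =
      Finset.Ioi ⟨m, by omega⟩ := by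
    ext x; simp [Fin.lt_def]
  change (Finset.univ.filter fun x : Fin (2 * m + 1) => m < x.val).card = m
  rw [this, Fin.card_Ioi]
  simp; omega

theorem card_leaf_level_two :
    (Finset.univ.filter fun x => d.role m (.inl (x, 2, 1)) = .leaf).card =
      m + if d.α = .leaf then 1 else 0 := by
  have h0 : d.role m (.inl (0, 2, 1)) = d.α := by simp [role, sixRole]
  have h1 : (Finset.univ.filter fun x => d.role m (.inl (x, 2, 1)) = .leaf) =
      (Finset.univ.filter fun x : ZMod (2 * m + 1) => m < x.val) ∪
        if d.α = .leaf then {0} else ∅ := by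
    ext x
    simp only [Finset.mem_filter, Finset.mem_univ, true_and, Finset.mem_union]
    by_cases hx : x = 0
    · rw [hx, h0]
      split_ifs with h <;> simp [h]
    · rw [d.role_level_two hx]
      have hx' : x ∉ (if d.α = .leaf then {0} else ∅ : Finset (ZMod (2 * m + 1))) := by
        split_ifs <;> simp [hx]
      simp only [hx', or_false]
      split_ifs with h <;> simp <;> omega
  rw [h1, Finset.card_union_of_disjoint, card_lt_val]
  · congr 1
    split_ifs <;> simp
  · rw [Finset.disjoint_left]
    intro x hx
    split_ifs
    · rw [Finset.mem_singleton]
      rintro rfl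
      simp at hx
    · simp

/-- The orders reached with groups of six points. -/
theorem mem_starOrders (hm : 3 ≤ m) {r a v : ℕ}
    (hr : (if d.α = .leaf then 1 else 0) + (if d.β = .leaf then 1 else 0) = r)
    (hv : v = 6 * (2 * m + 1) + 1) (ha : a - 1 = 3 * m + r) : v ∈ starOrders a := by
  refine (d.star hm).mem_starOrders ?_ ?_
  · simp [Fintype.card_sum, Fintype.card_prod, ZMod.card, hv]; ring
  · change Fintype.card {x // d.role m x = .leaf} = a - 1
    rw [Fintype.card_subtype, Finset.card_filter, Fintype.sum_sum_type, Fintype.sum_prod_type_right,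
      Fintype.sum_prod_type]
    have e2 : ∀ (g : ZMod 2 → ℕ), ∑ f, g f = g 0 + g 1 := fun g => Fin.sum_univ_two g
    have e3 : ∀ (g : ZMod 3 → ℕ), ∑ i, g i = g 0 + g 1 + g 2 := fun g => Fin.sum_univ_three g
    have e4 : ∀ (x : ZMod (2 * m + 1)) i, d.role m (.inl (x, i, 0)) ≠ .leaf := by
      intro x i
      rw [d.role_zero]
      split_ifs <;> simp
    simp only [e3, e2, e4, if_false, Finset.sum_const_zero, zero_add]
    rw [← Finset.card_filter, ← Finset.card_filter, ← Finset.card_filter,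
      d.card_leaf_level_zero hm, d.card_leaf_level_one hm, d.card_leaf_level_two, ha, ← hr]
    have e5 : ∑ b : Fin 1, (if d.role m (.inr b) = .leaf then 1 else 0) =
        if d.β = .leaf then 1 else 0 := Fin.sum_univ_one _
    rw [e5]
    omega

end SixFill

theorem mem_starOrders_of_mod_one {a : ℕ} (ha : 10 ≤ a) (h : a % 6 = 1) :
    4 * a + 3 ∈ starOrders a :=
  sixFillZero.mem_starOrders (m := 2 * (a / 6)) (r := 0) (by omega) (by decide)
    (by omega) (by omega)

theorem mem_starOrders_of_mod_two {a : ℕ} (ha : 10 ≤ a) (h : a % 6 = 2) :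
    4 * a - 1 ∈ starOrders a :=
  sixFillOne.mem_starOrders (m := 2 * (a / 6)) (r := 1) (by omega) (by decide)
    (by omega) (by omega)

theorem mem_starOrders_of_mod_three {a : ℕ} (ha : 10 ≤ a) (h : a % 6 = 3) :
    4 * a - 5 ∈ starOrders a :=
  sixFillTwo.mem_starOrders (m := 2 * (a / 6)) (r := 2) (by omega) (by decide)
    (by omega) (by omega)

/-! ### The doubling construction -/

section Doubling

variable {R : Type*} [CommRing R] [DecidableEq R]

/-- The doubling construction: the points of a system on `R` are the one-factors of the complete
graph on `R ∪ {∞}`, where the one-factor of `a` consists of the pairs with sum `2 a` and of the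
pair of `a` and `∞`. Here `h` stands for `1 / 2`. -/
def doubleOp (s : SteinerOp R) (h : R) : R ⊕ Option R → R ⊕ Option R → R ⊕ Option R
  | .inl a, .inl b => .inl (s.op a b)
  | .inl a, .inr none => .inr (some a)
  | .inl a, .inr (some x) => if a = x then .inr none else .inr (some (2 * a - x))
  | .inr none, .inl a => .inr (some a)
  | .inr none, .inr none => .inr none
  | .inr none, .inr (some x) => .inl x
  | .inr (some x), .inl a => if a = x then .inr none else .inr (some (2 * a - x))
  | .inr (some x), .inr none => .inl x
  | .inr (some x), .inr (some y) => if x = y then .inr (some x) else .inl (h * (x + y))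

/-- The Steiner quasigroup of the doubling construction. -/
def doubleSteinerOp (s : SteinerOp R) {h : R} (hh : 2 * h = 1) : SteinerOp (R ⊕ Option R) where
  op := doubleOp s h
  comm := by
    rintro (a | _ | x) (b | _ | y) <;> simp only [doubleOp]
    · rw [s.comm]
    · by_cases hxy : x = y
      · simp [hxy]
      · rw [if_neg hxy, if_neg (Ne.symm hxy), add_comm]
  op_op := by
    have two : ∀ w : R, 2 * w = 0 → w = 0 := fun w hw => by
      linear_combination h * hw - w * hh
    rintro (a | _ | x) (b | _ | y)
    · simp [doubleOp, s.op_op]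
    · simp [doubleOp]
    · by_cases e : a = y
      · simp [doubleOp, e]
      · have : a ≠ 2 * a - y := fun e' => e (by linear_combination -e')
        simp [doubleOp, e, this]
    · simp [doubleOp]
    · simp [doubleOp]
    · simp [doubleOp]
    · by_cases e : b = x
      · simp [doubleOp, e]
      · have e1 : x ≠ 2 * b - x := fun e' => e (by
          have := two (b - x) (by linear_combination -e')
          linear_combination this)
        have e2 : h * (x + (2 * b - x)) = b := by linear_combination b * hh
        simp only [doubleOp, if_neg e, if_neg e1, e2]
    · simp [doubleOp]
    · by_cases e : x = y
      · simp [doubleOp, e]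
      · have e1 : h * (x + y) ≠ x := fun e' => e (by
          linear_combination -2 * e' + (x + y) * hh)
        have e2 : 2 * (h * (x + y)) - x = y := by linear_combination (x + y) * hh
        simp only [doubleOp, if_neg e, if_neg e1, e2]
  idem := by
    rintro (a | _ | x)
    · simp [doubleOp, s.idem]
    · simp [doubleOp]
    · simp [doubleOp]

/-- In the doubled system the center is the point `0` of the original system, and `∞` and a set `T`
of representatives of the pairs `{x, -x}` are played. -/
def doubleRole (T : Finset R) : R ⊕ Option R → Role
  | .inl a => if a = 0 then .center else .dead
  | .inr none => .played
  | .inr (some x) => if x ∈ T then .played else .leaf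

/-- A star position in the doubled system. The last condition says that each one-factor other than
that of the center contains a pair of played points. -/
def doubleStar (s : SteinerOp R) {h : R} (hh : 2 * h = 1) (T : Finset R) (h0 : 0 ∉ T)
    (hT : ∀ x, x ≠ 0 → (-x ∈ T ↔ x ∉ T))
    (hsum : ∀ a, a ≠ 0 → a ∈ T ∨ ∃ x ∈ T, ∃ y ∈ T, x ≠ y ∧ x + y = 2 * a) :
    StarSystem (R ⊕ Option R) where
  toSteinerOp := doubleSteinerOp s hh
  role := doubleRole T
  fits := by
    have half : ∀ x y : R, h * (x + y) = 0 → x = -y := fun x y e => by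
      linear_combination 2 * e - (x + y) * hh
    rintro (a | _ | x) (b | _ | y) hne <;> simp only [doubleSteinerOp, doubleOp, doubleRole]
    · split_ifs <;> trivial
    · split_ifs <;> trivial
    · by_cases ha : a = 0
      · by_cases hy : y ∈ T
        · simp only [if_pos ha, if_pos hy]; trivial
        · by_cases e : a = y
          · simp only [if_pos ha, if_neg hy, if_pos e]; rfl
          · have hy0 : y ≠ 0 := fun h => e (ha.trans h.symm)
            have : 2 * a - y ∈ T := by
              rw [ha, mul_zero, zero_sub]; exact (hT y hy0).2 hy
            simp only [if_pos ha, if_neg hy, if_neg e, if_pos this]; rfl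
      · simp only [if_neg ha]; trivial
    · split_ifs <;> trivial
    · exact absurd rfl hne
    · by_cases hy : y ∈ T
      · have : y ≠ 0 := fun e => h0 (e ▸ hy)
        simp only [if_pos hy, if_neg this]; rfl
      · simp only [if_neg hy]; trivial
    · split_ifs <;> trivial
    · by_cases hx : x ∈ T
      · have : x ≠ 0 := fun e => h0 (e ▸ hx)
        simp only [if_pos hx, if_neg this]; rfl
      · simp only [if_neg hx]; trivial
    · have hxy : x ≠ y := fun e => hne (by rw [e])
      simp only [if_neg hxy]
      by_cases e : h * (x + y) = 0
      · have e' := half x y e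
        have hy0 : y ≠ 0 := fun h => hxy (by rw [e', h, neg_zero])
        have := hT y hy0
        rw [← e'] at this
        by_cases hy : y ∈ T
        · have hx : x ∉ T := fun h => this.1 h hy
          simp only [if_pos hy, if_neg hx]; trivial
        · simp only [if_neg hy, if_pos (this.2 hy)]; trivial
      · simp only [if_neg e]
        split_ifs <;> first | rfl | trivial
  dead := by
    rintro (a | _ | x) hz
    · have ha : a ≠ 0 := by rintro rfl; simp [doubleRole] at hz
      rcases hsum a ha with haT | ⟨x, hx, y, hy, hxy, e⟩
      · exact ⟨.inr none, .inr (some a), by simp, rfl, by simp [doubleRole, haT], rfl⟩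
      · refine ⟨.inr (some x), .inr (some y), by simpa using hxy, by simp [doubleRole, hx],
          by simp [doubleRole, hy], ?_⟩
        change doubleOp s h (.inr (some x)) (.inr (some y)) = .inl a
        simp only [doubleOp, if_neg hxy]
        congr 1
        linear_combination h * e + a * hh
    · cases hz
    · simp only [doubleRole] at hz; split_ifs at hz
  center := by
    refine ⟨.inl 0, by simp [doubleRole], ?_⟩
    rintro (a | _ | x) hz
    · simp only [doubleRole] at hz
      split_ifs at hz with h
      rw [h]
    · cases hz
    · simp only [doubleRole] at hz; split_ifs at hz

theorem doubleStar_card_leaf [Fintype R] (T : Finset R) :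
    Fintype.card {x // doubleRole T x = .leaf} = Fintype.card R - T.card := by
  rw [Fintype.card_subtype, Finset.card_filter, Fintype.sum_sum_type, Fintype.sum_option]
  have e1 : ∀ a, doubleRole T (.inl a) ≠ .leaf := by
    intro a
    simp only [doubleRole]
    split_ifs <;> simp
  have e2 : doubleRole T (.inr none) ≠ .leaf := by simp [doubleRole]
  have e3 : ∀ x, doubleRole T (.inr (some x)) = .leaf ↔ x ∈ Tᶜ := by
    intro x
    simp [doubleRole]
  simp only [e1, e2, e3, if_false, Finset.sum_const_zero, zero_add]
  rw [← Finset.card_filter, Finset.filter_mem_eq_inter, Finset.univ_inter, Finset.card_compl]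

end Doubling

/-! ### Systems of small order -/

/-- The cyclic Steiner quasigroup with the block `{0, d, f d}` through `0` and `d`. -/
def cyclicOp {G : Type*} [AddCommGroup G] (f : G → G) (h0 : f 0 = 0) (hf : ∀ d, f (f d) = d)
    (hneg : ∀ d, f d = d + f (-d)) : SteinerOp G where
  op x y := x + f (y - x)
  comm x y := by
    rw [hneg, neg_sub]; abel
  op_op x y := by
    rw [add_sub_cancel_left, hf]; abel
  idem x := by rw [sub_self, h0, add_zero]

/-- The function on residues with the list `l` of values. -/
def listFun {n : ℕ} (l : List ℕ) (x : ZMod n) : ZMod n := (l.getD x.val 0 : ℕ)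

def cyclicSeven : SteinerOp (ZMod 7) :=
  cyclicOp (listFun [0, 3, 6, 1, 5, 4, 2]) (by decide +kernel) (by decide +kernel)
    (by decide +kernel)

def cyclicThirteen : SteinerOp (ZMod 13) :=
  cyclicOp (listFun [0, 4, 7, 12, 1, 11, 8, 2, 6, 10, 9, 5, 3]) (by decide +kernel)
    (by decide +kernel) (by decide +kernel)

def cyclicFifteen : SteinerOp (ZMod 15) :=
  cyclicOp (listFun [0, 4, 8, 14, 1, 10, 13, 9, 2, 7, 5, 12, 11, 6, 3]) (by decide +kernel)
    (by decide +kernel) (by decide +kernel)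

def cyclicNineteen : SteinerOp (ZMod 19) :=
  cyclicOp (listFun [0, 4, 9, 18, 1, 11, 14, 17, 13, 2, 12, 5, 10, 8, 6, 16, 15, 7, 3])
    (by decide +kernel) (by decide +kernel) (by decide +kernel)

/-- The roles with the center `0` and the lists `p` of played points and `l` of leaves. -/
def listRole (p l : List ℕ) (x : ℕ) : Role :=
  if x = 0 then .center else if x ∈ p then .played else if x ∈ l then .leaf else .dead

/-- A Steiner triple system of order 25 in which the points from 1 to 12 contain no block and the
blocks `{0, x, x + 6}` pair them. -/
def table25 : List (List ℕ) := [
  [0, 7, 8, 9, 10, 11, 12, 1, 2, 3, 4, 5, 6, 14, 13, 16, 15, 18, 17, 20, 19, 22, 21, 24, 23],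
  [7, 1, 13, 14, 16, 18, 22, 0, 17, 19, 20, 15, 24, 2, 3, 11, 4, 8, 5, 9, 10, 23, 6, 21, 12],
  [8, 13, 2, 24, 23, 14, 21, 15, 0, 22, 19, 16, 18, 1, 5, 7, 11, 20, 12, 10, 17, 6, 9, 4, 3],
  [9, 14, 24, 3, 15, 16, 18, 17, 20, 0, 13, 21, 22, 10, 1, 4, 5, 7, 6, 23, 8, 11, 12, 19, 2],
  [10, 16, 23, 15, 4, 20, 19, 18, 14, 17, 0, 24, 21, 22, 8, 3, 1, 9, 7, 6, 5, 12, 13, 2, 11],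
  [11, 18, 14, 16, 20, 5, 17, 23, 24, 13, 22, 0, 15, 9, 2, 12, 3, 6, 1, 21, 4, 19, 10, 7, 8],
  [12, 22, 21, 18, 19, 17, 6, 20, 23, 14, 16, 13, 0, 11, 9, 24, 10, 5, 3, 4, 7, 2, 1, 8, 15],
  [1, 0, 15, 17, 18, 23, 20, 7, 13, 16, 21, 14, 19, 8, 11, 2, 9, 3, 4, 12, 6, 10, 24, 5, 22],
  [2, 17, 0, 20, 14, 24, 23, 13, 8, 21, 18, 19, 16, 7, 4, 22, 12, 1, 10, 11, 3, 9, 15, 6, 5],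
  [3, 19, 22, 0, 17, 13, 14, 16, 21, 9, 15, 18, 23, 5, 6, 10, 7, 4, 11, 1, 24, 8, 2, 12, 20],
  [4, 20, 19, 13, 0, 22, 16, 21, 18, 15, 10, 23, 14, 3, 12, 9, 6, 24, 8, 2, 1, 7, 5, 11, 17],
  [5, 15, 16, 21, 24, 0, 13, 14, 19, 18, 23, 11, 17, 6, 7, 1, 2, 12, 9, 8, 22, 3, 20, 10, 4],
  [6, 24, 18, 22, 21, 15, 0, 19, 16, 23, 14, 17, 12, 20, 10, 5, 8, 11, 2, 7, 13, 4, 3, 9, 1],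
  [14, 2, 1, 10, 22, 9, 11, 8, 7, 5, 3, 6, 20, 13, 0, 17, 23, 15, 21, 24, 12, 18, 4, 16, 19],
  [13, 3, 5, 1, 8, 2, 9, 11, 4, 6, 12, 7, 10, 0, 14, 23, 20, 21, 24, 22, 16, 17, 19, 15, 18],
  [16, 11, 7, 4, 3, 12, 24, 2, 22, 10, 9, 1, 5, 17, 23, 15, 0, 13, 19, 18, 21, 20, 8, 14, 6],
  [15, 4, 11, 5, 1, 3, 10, 9, 12, 7, 6, 2, 8, 23, 20, 0, 16, 19, 22, 17, 14, 24, 18, 13, 21],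
  [18, 8, 20, 7, 9, 6, 5, 3, 1, 4, 24, 12, 11, 15, 21, 13, 19, 17, 0, 16, 2, 14, 23, 22, 10],
  [17, 5, 12, 6, 7, 1, 3, 4, 10, 11, 8, 9, 2, 21, 24, 19, 22, 0, 18, 15, 23, 13, 16, 20, 14],
  [20, 9, 10, 23, 6, 21, 4, 12, 11, 1, 2, 8, 7, 24, 22, 18, 17, 16, 15, 19, 0, 5, 14, 3, 13],
  [19, 10, 17, 8, 5, 4, 7, 6, 3, 24, 1, 22, 13, 12, 16, 21, 14, 2, 23, 0, 20, 15, 11, 18, 9],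
  [22, 23, 6, 11, 12, 19, 2, 10, 9, 8, 7, 3, 4, 18, 17, 20, 24, 14, 13, 5, 15, 21, 0, 1, 16],
  [21, 6, 9, 12, 13, 10, 1, 24, 15, 2, 5, 20, 3, 4, 19, 8, 18, 23, 16, 14, 11, 0, 22, 17, 7],
  [24, 21, 4, 19, 2, 7, 8, 5, 6, 12, 11, 10, 9, 16, 15, 14, 13, 22, 20, 3, 18, 1, 17, 23, 0],
  [23, 12, 3, 2, 11, 8, 15, 22, 5, 20, 17, 4, 1, 19, 18, 6, 21, 10, 14, 13, 9, 16, 7, 0, 24]]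

theorem one_mem_starOrders_one : 1 ∈ starOrders 1 := by
  let s : StarSystem (Fin 1) :=
    { op := fun _ _ => 0
      comm := by decide
      op_op := by decide
      idem := by decide
      role := fun _ => .center
      fits := by decide
      dead := by decide
      center := ⟨0, rfl, by decide⟩ }
  exact s.mem_starOrders (by decide) (by decide)

theorem three_mem_starOrders_two : 3 ∈ starOrders 2 := by
  let s : StarSystem (ZMod 3) :=
    { op := fun x y => -(x + y)
      comm := by decide
      op_op := by decide
      idem := by decide
      role := fun x => listRole [1] [2] x.val
      fits := by decide
      dead := by decide
      center := ⟨0, rfl, by decide⟩ }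
  exact s.mem_starOrders (by decide) (by decide)

theorem thirteen_mem_starOrders_three : 13 ∈ starOrders 3 := by
  let s : StarSystem (ZMod 13) :=
    { toSteinerOp := cyclicThirteen
      role := fun x => listRole [1, 9, 11, 12] [4, 5] x.val
      fits := by decide +kernel
      dead := by decide +kernel
      center := ⟨0, rfl, by decide +kernel⟩ }
  exact s.mem_starOrders (by decide) (by decide +kernel)

theorem nineteen_mem_starOrders_four : 19 ∈ starOrders 4 := by
  let s : StarSystem (ZMod 19) :=
    { toSteinerOp := cyclicNineteen
      role := fun x => listRole [2, 5, 8, 14, 15] [9, 11, 13] x.val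
      fits := by decide +kernel
      dead := by decide +kernel
      center := ⟨0, rfl, by decide +kernel⟩ }
  exact s.mem_starOrders (by decide) (by decide +kernel)

theorem twentyFive_mem_starOrders_seven : 25 ∈ starOrders 7 := by
  let s : StarSystem (Fin 25) :=
    { op := fun x y => Fin.ofNat 25 (tableOp table25 x.val y.val)
      comm := by decide +kernel
      op_op := by decide +kernel
      idem := by decide +kernel
      role := fun x => listRole [1, 2, 3, 4, 5, 6] [7, 8, 9, 10, 11, 12] x.val
      fits := by decide +kernel
      dead := by decide +kernel
      center := ⟨0, rfl, by decide +kernel⟩ }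
  exact s.mem_starOrders (by decide) (by decide +kernel)

theorem fifteen_mem_starOrders_five : 15 ∈ starOrders 5 :=
  (doubleStar cyclicSeven (h := 4) (by decide) {1, 2, 4} (by decide) (by decide +kernel)
    (by decide +kernel)).mem_starOrders (by decide) (doubleStar_card_leaf _)

theorem nineteen_mem_starOrders_six : 19 ∈ starOrders 6 :=
  (doubleStar (R := ZMod 9) affinePlane (h := 5) (by decide) {1, 2, 3, 5} (by decide)
    (by decide +kernel) (by decide +kernel)).mem_starOrders (by decide) (doubleStar_card_leaf _)

theorem twentySeven_mem_starOrders_eight : 27 ∈ starOrders 8 :=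
  (doubleStar cyclicThirteen (h := 7) (by decide) {1, 2, 3, 4, 5, 7} (by decide)
    (by decide +kernel) (by decide +kernel)).mem_starOrders (by decide) (doubleStar_card_leaf _)

theorem thirtyOne_mem_starOrders_nine : 31 ∈ starOrders 9 :=
  (doubleStar cyclicFifteen (h := 8) (by decide) {1, 2, 3, 4, 5, 6, 8} (by decide)
    (by decide +kernel) (by decide +kernel)).mem_starOrders (by decide) (doubleStar_card_leaf _)

/-! ### The orders of the embeddings of stars -/

theorem isLeast_starOrders {a v : ℕ} (hv : v ∈ starOrders a)
    (h : ∀ w, AdmissibleOrder w → 4 * a - 6 ≤ w → v ≤ w) : IsLeast (starOrders a) v :=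
  ⟨hv, fun w hw => h w (admissibleOrder_of_mem_starOrders hw) (le_of_mem_starOrders hw)⟩

theorem isKthAdmissibleFrom_two {L v u : ℕ} (hv : AdmissibleOrder v) (hL : L ≤ v)
    (h : ∀ w, AdmissibleOrder w ∧ L ≤ w ∧ w < v ↔ w = u) : IsKthAdmissibleFrom L 2 v := by
  refine ⟨hv, hL, ?_⟩
  have : {w | AdmissibleOrder w ∧ L ≤ w ∧ w < v} = {u} := Set.ext h
  rw [this, Set.ncard_singleton]

theorem isKthAdmissibleFrom_three {L v u u' : ℕ} (hv : AdmissibleOrder v) (hL : L ≤ v)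
    (hne : u ≠ u') (h : ∀ w, AdmissibleOrder w ∧ L ≤ w ∧ w < v ↔ w = u ∨ w = u') :
    IsKthAdmissibleFrom L 3 v := by
  refine ⟨hv, hL, ?_⟩
  have : {w | AdmissibleOrder w ∧ L ≤ w ∧ w < v} = {u, u'} := Set.ext h
  rw [this, Set.ncard_pair hne]

theorem mem_starOrders_of_mod_three_or_five {a : ℕ} (ha : 9 ≤ a) (h : a % 6 = 3 ∨ a % 6 = 5) :
    4 * a - 5 ∈ starOrders a := by
  rcases h with h | h
  · by_cases h9 : a = 9
    · subst h9; exact thirtyOne_mem_starOrders_nine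
    · exact mem_starOrders_of_mod_three (by omega) h
  · exact mem_starOrders_of_mod_five ha h

theorem mainTheorem2 :
    -- The minimal orders for stars with at most nine vertices.
    (IsLeast (starOrders 1) 1 ∧ IsLeast (starOrders 2) 3 ∧ IsLeast (starOrders 3) 13 ∧
      IsLeast (starOrders 4) 19 ∧ IsLeast (starOrders 5) 15 ∧ IsLeast (starOrders 6) 19 ∧
      IsLeast (starOrders 7) 25 ∧ IsLeast (starOrders 8) 27 ∧ IsLeast (starOrders 9) 31) ∧
    ∀ a : ℕ, 9 ≤ a →
      -- The embeddings.
      (a % 6 = 0 ∨ a % 6 = 4 → 4 * a - 3 ∈ starOrders a) ∧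
      (a % 6 = 1 → 4 * a + 3 ∈ starOrders a) ∧
      (a % 6 = 2 → 4 * a - 1 ∈ starOrders a) ∧
      (a % 6 = 3 ∨ a % 6 = 5 → 4 * a - 5 ∈ starOrders a) ∧
      -- The orders of the embeddings that are minimal.
      (a % 6 = 3 ∨ a % 6 = 5 → IsLeast (starOrders a) (4 * a - 5)) ∧
      (a % 6 = 4 → IsLeast (starOrders a) (4 * a - 3)) ∧
      -- Every embedding has an admissible order of at least `4 a - 6`, and the remaining orders
      -- above are the second and third smallest among these possible orders.
      (∀ v ∈ starOrders a, AdmissibleOrder v ∧ 4 * a - 6 ≤ v) ∧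
      (a % 6 = 0 → IsKthAdmissibleFrom (4 * a - 6) 2 (4 * a - 3)) ∧
      (a % 6 = 2 → IsKthAdmissibleFrom (4 * a - 6) 2 (4 * a - 1)) ∧
      (a % 6 = 1 → IsKthAdmissibleFrom (4 * a - 6) 3 (4 * a + 3)) := by
  refine ⟨⟨?_, ?_, ?_, ?_, ?_, ?_, ?_, ?_, ?_⟩, fun a ha =>
    ⟨?_, ?_, ?_, ?_, ?_, ?_, ?_, ?_, ?_, ?_⟩⟩
  · exact isLeast_starOrders one_mem_starOrders_one fun w hw _ => by
      unfold AdmissibleOrder at hw; omega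
  · exact isLeast_starOrders three_mem_starOrders_two fun w hw _ => by
      unfold AdmissibleOrder at hw; omega
  · refine ⟨thirteen_mem_starOrders_three, fun w hw => ?_⟩
    have h1 := admissibleOrder_of_mem_starOrders hw
    have h2 := eleven_le_of_mem_starOrders_three hw
    unfold AdmissibleOrder at h1; omega
  · refine ⟨nineteen_mem_starOrders_four, fun w hw => ?_⟩
    have h1 := admissibleOrder_of_mem_starOrders hw
    have h2 := sixteen_le_of_mem_starOrders_four hw
    unfold AdmissibleOrder at h1; omega
  · exact isLeast_starOrders fifteen_mem_starOrders_five fun w hw _ => by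
      unfold AdmissibleOrder at hw; omega
  · exact isLeast_starOrders nineteen_mem_starOrders_six fun w hw _ => by
      unfold AdmissibleOrder at hw; omega
  · exact isLeast_starOrders twentyFive_mem_starOrders_seven fun w hw _ => by
      unfold AdmissibleOrder at hw; omega
  · exact isLeast_starOrders twentySeven_mem_starOrders_eight fun w hw _ => by
      unfold AdmissibleOrder at hw; omega
  · exact isLeast_starOrders thirtyOne_mem_starOrders_nine fun w hw _ => by
      unfold AdmissibleOrder at hw; omega
  · rintro (h | h)
    · exact mem_starOrders_of_mod_zero ha h
    · exact mem_starOrders_of_mod_four ha h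
  · exact fun h => mem_starOrders_of_mod_one (by omega) h
  · exact fun h => mem_starOrders_of_mod_two (by omega) h
  · exact mem_starOrders_of_mod_three_or_five ha
  · exact fun h => isLeast_starOrders (mem_starOrders_of_mod_three_or_five ha h) fun w hw hw' => by
      unfold AdmissibleOrder at hw; omega
  · exact fun h => isLeast_starOrders (mem_starOrders_of_mod_four ha h) fun w hw hw' => by
      unfold AdmissibleOrder at hw; omega
  · exact fun v hv => ⟨admissibleOrder_of_mem_starOrders hv, le_of_mem_starOrders hv⟩
  · exact fun h => isKthAdmissibleFrom_two (u := 4 * a - 5) (by unfold AdmissibleOrder; omega)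
      (by omega) fun w => by unfold AdmissibleOrder; omega
  · exact fun h => isKthAdmissibleFrom_two (u := 4 * a - 5) (by unfold AdmissibleOrder; omega)
      (by omega) fun w => by unfold AdmissibleOrder; omega
  · exact fun h => isKthAdmissibleFrom_three (u := 4 * a - 3) (u' := 4 * a - 1)
      (by unfold AdmissibleOrder; omega) (by omega) (by omega) fun w => by
        unfold AdmissibleOrder; omega
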